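/- Let $X=\prod_{n\in\mathbb N}\mathbb Z_2$ ($\mathbb N=\{1,2,\dots\}$) with the product topology, let $\mathcal A=C(X,\mathbb C)$, and let $\mu$ be the product on $X$ of the uniform probability measures on the factors. Let $e_n\in\mathcal A$ be the $n$-th coordinate function (with values $0,1$), put $\mathcal A_0=\mathbb C I$, and for $n\ge 1$ let $\mathcal A_n$ be the unital self-adjoint subalgebra of $\mathcal A$ generated by $e_1,\dots,e_n$. Let $\mathcal A$ act on $H=L^2(X,\mu)$ by multiplication, let $\xi\in H$ be the constant function $1$, let $P_n$ be the orthogonal projection of $H$ onto the finite-dimensional space $H_n=\mathcal A_n\xi$, and put $Q_0=P_0$ and $Q_n=P_n-P_{n-1}$ for $n\ge 1$. For a real sequence $(\alpha_n)_{n\ge 0}$ with $\alpha_0=0$ let $$D=\sum_{n=1}^\infty \alpha_nQ_n ,$$ with domain the set of all vectors at which the series converges. For states $\varphi,\psi$ of $\mathcal A$ put $$d(\varphi,\psi)=\sup\{|\varphi(a)-\psi(a)| : a\in\mathcal A,\ \|[D,a]\|\le 1\}\in[0,\infty],$$ where $\|[D,a]\|\le 1$ means that the commutator $Da-aD$, with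 domain $\{\eta\in\operatorname{dom}D : a\eta\in\operatorname{dom}D\}$, is densely defined and extends to a bounded operator on $H$ of norm at most $1$. For $x,y\in X$ let $d_{(\alpha_n)}(x,y)$ be the distance of the point evaluations at $x$ and $y$. **Theorem.** (i) Let $(\alpha_n)_{n\ge 0}$ be a sequence of real numbers such that $$\alpha_0=0\quad\text{and}\quad \sum_{n=1}^\infty \sup\{|\alpha_n-\alpha_i|^{-1} : 0\le i\le n-1\}<\infty$$ (with $0^{-1}=\infty$). Then $(H,D)$ is an unbounded Fredholm module over $\mathcal A$, that is, $D$ is self-adjoint, the set of all $a\in\mathcal A$ for which $[D,a]$ is densely defined and extends to a bounded operator is norm dense in $\mathcal A$, and $(I+D^2)^{-1}$ is compact. Moreover, $d$ is a (finite) metric on the state space of $\mathcal A$ which induces the weak*-topology, and $d_{(\alpha_n)}$ is a metric on $X$ which induces the product topology. (ii) Let $0<\gamma<1$, $\alpha_0=0$ and $\alpha_n=\gamma^{-n+1}$ for $n\ge 1$. Then the conditions in (i) are fulfilled. For $p>0$ the module is $p$-summable, i.e. $\operatorname{trace}\big((I+D^2)^{-p/2}\big)<\infty$, if and only if $p>\frac{\log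 2}{-\log\gamma}$. Writing $d_\gamma$ for the metric on $X$ in this case and $m(x,y)=\min\{n\in\mathbb N : x(n)\ne y(n)\}$, one has for all $x\ne y$ in $X$ $$2\gamma^{m(x,y)-1}\ \le\ d_\gamma(x,y)\ \le\ 2\,\frac{\gamma^{m(x,y)-1}}{(1-\gamma)^2}.$$ -/

import Mathlib

open MeasureTheory
open scoped ENNReal

noncomputable section

/-! ### States of a unital C*-algebra, unbounded Fredholm modules, and the induced metric -/

section General

variable {A : Type*} [CStarAlgebra A]
variable {H : Type*} [NormedAddCommGroup H] [InnerProductSpace ℂ H] [CompleteSpace H]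

open scoped ComplexOrder in
/-- The state space of a unital C*-algebra: the positive unital functionals, with the
weak*-topology (the subspace topology inherited from `WeakDual ℂ A`). -/
abbrev StateSpace (A : Type*) [CStarAlgebra A] : Type _ :=
  {φ : WeakDual ℂ A // φ 1 = 1 ∧ ∀ a : A, 0 ≤ φ (star a * a)}

/-- `T` is the bounded extension of the commutator `[D, S]`. The commutator `D S - S D` has its
natural domain `{ξ ∈ dom D | S ξ ∈ dom D}`, which is required to be dense. -/
structure IsCommutatorExtension (D : H →ₗ.[ℂ] H) (S T : H →L[ℂ] H) : Prop where
  dense_domain : Dense {ξ : H | ξ ∈ D.domain ∧ S ξ ∈ D.domain}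
  eq_commutator : ∀ (ξ : H) (h : ξ ∈ D.domain) (h' : S ξ ∈ D.domain),
    T ξ = D ⟨S ξ, h'⟩ - S (D ⟨ξ, h⟩)

/-- `R` is the bounded everywhere defined inverse `(I + D²)⁻¹`, where `D²` has its natural domain
`{ξ ∈ dom D | D ξ ∈ dom D}`. -/
structure IsInverseOneAddSq (D : H →ₗ.[ℂ] H) (R : H →L[ℂ] H) : Prop where
  right_inv : ∀ ξ : H, ∃ (h : R ξ ∈ D.domain) (h' : D ⟨R ξ, h⟩ ∈ D.domain),
    R ξ + D ⟨D ⟨R ξ, h⟩, h'⟩ = ξ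
  left_inv : ∀ (ξ : H) (h : ξ ∈ D.domain) (h' : D ⟨ξ, h⟩ ∈ D.domain),
    R (ξ + D ⟨D ⟨ξ, h⟩, h'⟩) = ξ

/-- `(H, D)`, with `A` acting on `H` through the *-representation `π`, is an unbounded Fredholm
module over `A`. -/
structure IsUnboundedFredholmModule (π : A →⋆ₐ[ℂ] (H →L[ℂ] H)) (D : H →ₗ.[ℂ] H) : Prop where
  selfAdjoint : IsSelfAdjoint D
  dense_lipschitz : Dense {a : A | ∃ T : H →L[ℂ] H, IsCommutatorExtension D (π a) T}
  compact_resolvent : ∃ R : H →L[ℂ] H, IsInverseOneAddSq D R ∧ IsCompactOperator R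

/-- A positive operator has finite trace: `∑ ⟨e, T e⟩` converges over every orthonormal basis. -/
def HasFiniteTrace (T : H →L[ℂ] H) : Prop :=
  ∀ (s : Set H) (b : HilbertBasis s ℂ H),
    Summable fun i : s => @inner ℂ H InnerProductSpace.toInner (b i) (T (b i))

/-- `p`-summability, `trace ((I + D²)^(-p/2)) < ∞`. The power of the positive operator
`(I + D²)⁻¹` is the one of the continuous functional calculus. -/
def IsPSummable (D : H →ₗ.[ℂ] H) (p : ℝ) : Prop :=
  0 < p ∧ ∃ R : H →L[ℂ] H, IsInverseOneAddSq D R ∧ HasFiniteTrace (R ^ (p / 2))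

/-- The (possibly infinite) distance `sup {|φ(a) - ψ(a)| : a ∈ A, ‖[D, a]‖ ≤ 1}` of two states. -/
def stateEDist (π : A →⋆ₐ[ℂ] (H →L[ℂ] H)) (D : H →ₗ.[ℂ] H) (φ ψ : StateSpace A) : ℝ≥0∞ :=
  ⨆ a ∈ {a : A | ∃ T : H →L[ℂ] H, IsCommutatorExtension D (π a) T ∧ ‖T‖ ≤ 1},
    ‖φ.1 a - ψ.1 a‖ₑ

/-- The diagonal operator `∑_{n ≥ 1} α n • Q n`, whose domain consists of all the vectors at which
the series converges. -/
def diagonalOperator (α : ℕ → ℝ) (Q : ℕ → H →L[ℂ] H) : H →ₗ.[ℂ] H where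
  domain :=
    { carrier := {ξ | Summable fun n : ℕ => (α (n + 1) : ℂ) • Q (n + 1) ξ}
      add_mem' := fun {ξ η} hξ hη => by
        have h := Summable.add hξ hη
        simpa only [Set.mem_ofPred_eq, map_add, smul_add] using h
      zero_mem' := by
        simp only [Set.mem_ofPred_eq, map_zero, smul_zero]
        exact summable_zero
      smul_mem' := fun c ξ hξ => by
        have h := Summable.const_smul c hξ
        simpa only [Set.mem_ofPred_eq, map_smul, smul_comm c] using h }
  toFun :=
    { toFun := fun ξ => ∑' n : ℕ, (α (n + 1) : ℂ) • Q (n + 1) (ξ : H)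
      map_add' := fun ξ η => by
        have h := Summable.tsum_add ξ.2 η.2
        simpa only [Submodule.coe_add, map_add, smul_add] using h
      map_smul' := fun c ξ => by
        have h := Summable.tsum_const_smul c ξ.2
        simpa only [Submodule.coe_smul, map_smul, smul_comm c, RingHom.id_apply] using h }

end General

/-- The extended distance `d` is a (finite) metric which induces the given topology of `X`. -/
def IsMetricForTopology {X : Type*} [t : TopologicalSpace X] (d : X → X → ℝ≥0∞) : Prop :=
  ∃ m : MetricSpace X, (∀ x y : X, d x y = ENNReal.ofReal (m.dist x y)) ∧
    m.toPseudoMetricSpace.toUniformSpace.toTopologicalSpace = t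

/-! ### The Cantor set `∏ ℤ₂` and its algebra of continuous functions -/

/-- The product `∏ ℤ₂` of countably many copies of `ℤ₂`, with the product topology. The coordinate
that is counted as number `n + 1` when one starts from `1` is `x n`. -/
abbrev CantorGroup : Type := ℕ → ZMod 2

/-- The coordinate function with values `0` and `1`, as a projection of `C(∏ ℤ₂, ℂ)`. -/
def coordFun (i : ℕ) : C(CantorGroup, ℂ) where
  toFun x := ((x i).val : ℂ)
  continuous_toFun :=
    (continuous_of_discreteTopology (f := fun z : ZMod 2 => ((z.val : ℕ) : ℂ))).comp
      (continuous_apply i)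

/-- `𝒜ₙ`: the self-adjoint unital algebra generated by the first `n` coordinate functions. -/
def levelAlgebra (n : ℕ) : StarSubalgebra ℂ C(CantorGroup, ℂ) :=
  StarAlgebra.adjoin ℂ (coordFun '' {i : ℕ | i < n})

/-- The product measure on `∏ ℤ₂` of the uniform probability measures on the factors. -/
def cantorMeasure : Measure CantorGroup :=
  Measure.infinitePi fun _ : ℕ => (PMF.uniformOfFintype (ZMod 2)).toMeasure

instance : IsProbabilityMeasure cantorMeasure := by
  unfold cantorMeasure; infer_instance

/-- `L²(∏ ℤ₂, μ)`, the GNS Hilbert space of the state given by the product measure. Its cyclic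
vector is the constant function `1`. -/
abbrev CantorL2 : Type := Lp ℂ 2 cantorMeasure

/-- Multiplication by a continuous function as a bounded operator on `L²(∏ ℤ₂, μ)`. -/
def mulOperator (f : C(CantorGroup, ℂ)) : CantorL2 →L[ℂ] CantorL2 :=
  (ContinuousLinearMap.mul ℂ ℂ).holderL cantorMeasure ∞ 2 2
    (ContinuousMap.toLp ∞ cantorMeasure ℂ f)

lemma coeFn_mulOperator (f : C(CantorGroup, ℂ)) (ξ : CantorL2) :
    mulOperator f ξ =ᵐ[cantorMeasure] fun x => f x * ξ x := by
  have h1 := (ContinuousLinearMap.mul ℂ ℂ).coeFn_holder (r := 2)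
    (ContinuousMap.toLp ∞ cantorMeasure ℂ f) ξ
  have h2 := ContinuousMap.coeFn_toLp (p := ∞) (𝕜 := ℂ) cantorMeasure f
  refine Filter.EventuallyEq.trans (g := fun x =>
    (ContinuousMap.toLp ∞ cantorMeasure ℂ f : CantorGroup → ℂ) x * ξ x) h1 ?_
  filter_upwards [h2] with x hx
  rw [hx]

/-- The standard (GNS) representation of `C(∏ ℤ₂, ℂ)` on `L²(∏ ℤ₂, μ)` by multiplication. -/
def mulRep : C(CantorGroup, ℂ) →⋆ₐ[ℂ] (CantorL2 →L[ℂ] CantorL2) where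
  toFun := mulOperator
  map_one' := by
    ext1 ξ
    refine Lp.ext ?_
    filter_upwards [coeFn_mulOperator 1 ξ] with x hx
    rw [hx]; simp
  map_mul' f g := by
    ext1 ξ
    refine Lp.ext ?_
    filter_upwards [coeFn_mulOperator (f * g) ξ, coeFn_mulOperator f (mulOperator g ξ),
      coeFn_mulOperator g ξ] with x h1 h2 h3
    rw [mul_apply_eq_comp, h1, h2, h3, ContinuousMap.mul_apply, mul_assoc]
  map_zero' := by simp [mulOperator]
  map_add' f g := by simp [mulOperator]
  commutes' c := by
    ext1 ξ
    refine Lp.ext ?_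
    rw [Algebra.algebraMap_eq_smul_one, Algebra.algebraMap_eq_smul_one]
    have h0 : (c • (1 : CantorL2 →L[ℂ] CantorL2)) ξ = c • ξ := rfl
    rw [h0]
    filter_upwards [coeFn_mulOperator (c • 1) ξ, Lp.coeFn_smul c ξ] with x h1 h2
    rw [h1, h2]
    simp
  map_star' f := by
    rw [ContinuousLinearMap.star_eq_adjoint, ContinuousLinearMap.eq_adjoint_iff]
    intro ξ η
    rw [L2.inner_def, L2.inner_def]
    refine integral_congr_ae ?_
    filter_upwards [coeFn_mulOperator (star f) ξ, coeFn_mulOperator f η] with x h1 h2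
    rw [h1, h2]
    simp [mul_comm, mul_left_comm]

/-- The subspace `Hₙ = 𝒜ₙ ξ` of `L²(∏ ℤ₂, μ)`, where `ξ` is the constant function `1`. -/
def levelSpace (n : ℕ) : Submodule ℂ CantorL2 :=
  (Subalgebra.toSubmodule (levelAlgebra n).toSubalgebra).map
    (ContinuousMap.toLp 2 cantorMeasure ℂ : C(CantorGroup, ℂ) →L[ℂ] CantorL2).toLinearMap

lemma coordFun_mul_self (i : ℕ) : coordFun i * coordFun i = coordFun i := by
  ext x
  have h : ∀ z : ZMod 2, ((z.val : ℕ) : ℂ) * (z.val : ℕ) = (z.val : ℕ) := by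
    intro z
    have : z.val * z.val = z.val := by revert z; decide
    exact_mod_cast this
  exact h (x i)

instance finiteDimensional_levelSpace (n : ℕ) : FiniteDimensional ℂ (levelSpace n) := by
  have hfin : (coordFun '' {i : ℕ | i < n}).Finite := (Set.finite_lt_nat n).image _
  have hstar : star (coordFun '' {i : ℕ | i < n}) ⊆ coordFun '' {i : ℕ | i < n} := by
    rintro f ⟨i, hi, hf⟩
    refine ⟨i, hi, ?_⟩
    rw [← star_star f, ← hf]
    ext x
    exact (Complex.conj_natCast (x i).val).symm
  have h1 : (levelAlgebra n).toSubalgebra = Algebra.adjoin ℂ (coordFun '' {i : ℕ | i < n}) := by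
    rw [levelAlgebra, StarAlgebra.adjoin_toSubalgebra, Set.union_eq_self_of_subset_right hstar]
  have h2 : (Subalgebra.toSubmodule (levelAlgebra n).toSubalgebra).FG := by
    rw [h1]
    refine fg_adjoin_of_finite hfin ?_
    rintro f ⟨i, -, rfl⟩
    refine ⟨Polynomial.X ^ 2 - Polynomial.X,
      Polynomial.monic_X_pow_sub (by rw [Polynomial.degree_X]; norm_num), ?_⟩
    simp [sq, coordFun_mul_self]
  exact Module.Finite.iff_fg.mpr (h2.map _)

/-- The projections `Q₀ = P₀` and `Qₙ = Pₙ - Pₙ₋₁` (`n ≥ 1`), where `Pₙ` is the orthogonal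
projection of `L²(∏ ℤ₂, μ)` onto `Hₙ`. -/
def levelProj : ℕ → CantorL2 →L[ℂ] CantorL2
  | 0 => (levelSpace 0).starProjection
  | n + 1 => (levelSpace (n + 1)).starProjection - (levelSpace n).starProjection

/-- The Dirac operator `D = ∑_{n ≥ 1} α n • Q n`. -/
def cantorDirac (α : ℕ → ℝ) : CantorL2 →ₗ.[ℂ] CantorL2 :=
  diagonalOperator α levelProj

open scoped ComplexOrder in
/-- Point evaluation at `x` as a state of `C(∏ ℤ₂, ℂ)`. -/
def evalState (x : CantorGroup) : StateSpace C(CantorGroup, ℂ) :=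
  ⟨StrongDual.toWeakDual (ContinuousMap.evalCLM ℂ x), by
    simp [ContinuousMap.evalCLM], fun f => by
    have h : 0 ≤ star (f x) * f x := star_mul_self_nonneg _
    simpa [ContinuousMap.evalCLM] using h⟩

/-- The distance `d_(α)` which the Dirac operator induces on the points of `∏ ℤ₂`. -/
def cantorEDist (α : ℕ → ℝ) (x y : CantorGroup) : ℝ≥0∞ :=
  stateEDist mulRep (cantorDirac α) (evalState x) (evalState y)

/-- The growth condition `∑_{n ≥ 1} sup {|α n - α i|⁻¹ : 0 ≤ i ≤ n - 1} < ∞`. The terms are taken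
in `[0, ∞]`, so that `0⁻¹ = ∞`; the summation index is shifted by one. -/
def GrowthCondition (α : ℕ → ℝ) : Prop :=
  ∑' n : ℕ, ⨆ (i : ℕ) (_ : i ≤ n), (ENNReal.ofReal |α (n + 1) - α i|)⁻¹ < ∞

/-- The eigenvalues `α 0 = 0` and `α n = γ^(-n+1)` for `n ≥ 1`. -/
def geometricEigenvalues (γ : ℝ) (n : ℕ) : ℝ :=
  if n = 0 then 0 else γ ^ (-(n : ℤ) + 1)

/-- `m(x, y)`: the number (counted from `1`) of the first coordinate where `x` and `y` differ. -/
def firstDiffCoord (x y : CantorGroup) : ℕ :=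
  sInf {n : ℕ | 1 ≤ n ∧ x (n - 1) ≠ y (n - 1)}

end

/-! The Walsh functions form a group under multiplication (`walsh_mul`) and an orthonormal basis of
`L²`, and those of level at most `n` span `𝒜ₙ`. Hence `D` is diagonal, with eigenvalue `α (level S)`
at `walshVec S`. Self-adjointness and `(I + D²)⁻¹` are read off from coefficients, and compactness
follows because `(1 + α n ^ 2)⁻¹` is summable. Multiplication by a Walsh function permutes the basis
and conjugates `D` into a finite-rank perturbation of `D`, so all finite Walsh sums have bounded
commutators; they are dense in the algebra.

The metric statements rest on the matrix of a bounded commutator, `(α (level R) - α (level S)) *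
walshCoef (S ∆ R) a` (`IsCommutatorExtension.coef_apply_walshVec`). This is not automatic, since the
natural domain of the commutator is not known to contain the Walsh vectors. Conjugation by Walsh
functions shows that the deviation from this matrix depends only on `S ∆ R`; it is also square
summable, and pairing it with the dense domain gives zero.

Dividing by the gaps `α (n + 1) - α i` in the block from levels at most `n` to level `n + 1` bounds
the increment `levelExp (n + 1) a - levelExp n a` by `‖T‖ * gapSup α n`
(`norm_levelExp_succ_sub_le`). By the growth condition the tails are small uniformly over all `a`
with `‖[D, a]‖ ≤ 1`. So the distance of two states is controlled, up to a small error, by finitely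
many Walsh functions; it is finite and weak*-continuous. Conversely, convergence in `d` forces
convergence on Walsh sums, hence weak* convergence.

Points agreeing in the first `n` coordinates are separated only by the tail, which gives the upper
bound in (ii); a scaled one-coordinate Walsh function gives the lower bound. Since `2 ^ n` Walsh
functions have level `n + 1`, the trace is comparable to `∑ (2 * γ ^ p) ^ n`. -/

noncomputable section

open scoped symmDiff
open Filter Topology

/-! ### Walsh functions -/

/-- The Walsh function of a finite set of coordinates. -/
def walsh (S : Finset ℕ) : C(CantorGroup, ℂ) := ∏ i ∈ S, (1 - 2 * coordFun i)

lemma walsh_apply (S : Finset ℕ) (x : CantorGroup) :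
    walsh S x = ∏ i ∈ S, (1 - 2 * ((x i).val : ℂ)) := by
  rw [walsh, ContinuousMap.prod_apply]
  rfl

lemma sign_eq_one_or (z : ZMod 2) : (1 - 2 * (z.val : ℂ)) = 1 ∨ (1 - 2 * (z.val : ℂ)) = -1 := by
  have : z.val = 0 ∨ z.val = 1 := by have := z.val_lt; omega
  rcases this with h | h <;> rw [h] <;> norm_num

lemma walsh_eq_one_or (S : Finset ℕ) (x : CantorGroup) : walsh S x = 1 ∨ walsh S x = -1 := by
  rw [walsh_apply]
  induction S using Finset.induction_on with
  | empty => simp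
  | insert i S hi ih =>
    rw [Finset.prod_insert hi]
    rcases ih with h | h <;> rcases sign_eq_one_or (x i) with h' | h' <;> rw [h, h'] <;> norm_num

lemma norm_walsh_apply (S : Finset ℕ) (x : CantorGroup) : ‖walsh S x‖ = 1 := by
  rcases walsh_eq_one_or S x with h | h <;> simp [h]

lemma star_walsh_apply (S : Finset ℕ) (x : CantorGroup) :
    (starRingEnd ℂ) (walsh S x) = walsh S x := by
  rcases walsh_eq_one_or S x with h | h <;> simp [h]

lemma star_walsh (S : Finset ℕ) : star (walsh S) = walsh S := by
  ext x
  exact star_walsh_apply S x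

@[simp] lemma walsh_empty : walsh ∅ = 1 := by simp [walsh]

lemma walsh_mul_self (S : Finset ℕ) : walsh S * walsh S = 1 := by
  ext x
  rcases walsh_eq_one_or S x with h | h <;> simp [h]

/-- The signs of the common coordinates occur twice and square to `1`, so only the symmetric
difference survives. -/
lemma walsh_mul (S R : Finset ℕ) : walsh S * walsh R = walsh (S ∆ R) := by
  have key : ∀ A B : Finset ℕ, Disjoint A B → walsh (A ∪ B) = walsh A * walsh B := fun A B h =>
    Finset.prod_union h
  have h1 : walsh S = walsh (S \ R) * walsh (S ∩ R) := by
    rw [← key _ _ (Finset.disjoint_sdiff_inter S R), Finset.sdiff_union_inter]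
  have h2 : walsh R = walsh (R \ S) * walsh (S ∩ R) := by
    rw [Finset.inter_comm, ← key _ _ (Finset.disjoint_sdiff_inter R S), Finset.sdiff_union_inter]
  have h3 : walsh (S ∆ R) = walsh (S \ R) * walsh (R \ S) := by
    rw [← key _ _ disjoint_sdiff_sdiff]; rfl
  calc walsh S * walsh R = (walsh (S \ R) * walsh (R \ S)) * (walsh (S ∩ R) * walsh (S ∩ R)) := by
        rw [h1, h2]; ring
    _ = _ := by rw [walsh_mul_self, mul_one, h3]

/-- Only the coordinates in `S` matter, so the integral lives on a finite product and factorises;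
each factor is the mean of a fair sign. -/
lemma integral_walsh {S : Finset ℕ} (hS : S.Nonempty) : ∫ x, walsh S x ∂cantorMeasure = 0 := by
  have h0 : ∫ z : ZMod 2, (1 - 2 * ((z.val : ℕ) : ℂ)) ∂(PMF.uniformOfFintype (ZMod 2)).toMeasure
      = 0 := by
    rw [PMF.integral_eq_sum]
    have hu : (Finset.univ : Finset (ZMod 2)) = {0, 1} := by decide
    rw [hu, Finset.sum_pair (by decide)]
    simp [ZMod.val_one]
    norm_num
  have h1 : ∀ x : CantorGroup, walsh S x
      = (fun y : (i : S) → ZMod 2 => ∏ i : S, (1 - 2 * (((y i).val : ℕ) : ℂ))) (S.restrict x) := by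
    intro x
    rw [walsh_apply]
    exact (Finset.prod_coe_sort S (fun i => 1 - 2 * ((x i).val : ℂ))).symm
  rw [integral_congr_ae (ae_of_all _ h1), cantorMeasure]
  refine (integral_restrict_infinitePi (X := fun _ : ℕ => ZMod 2) (s := S)
    (f := fun y : (i : S) → ZMod 2 => ∏ i : S, (1 - 2 * (((y i).val : ℕ) : ℂ))) _
    (measurable_of_finite _).aestronglyMeasurable).trans ?_
  rw [integral_fintype_prod_eq_prod (f := fun (_ : S) (z : ZMod 2) => (1 - 2 * ((z.val : ℕ) : ℂ)))]
  obtain ⟨i, hi⟩ := hS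
  exact Finset.prod_eq_zero (Finset.mem_univ ⟨i, hi⟩) h0

/-- The Walsh functions as vectors of `L²`. -/
def walshVec (S : Finset ℕ) : CantorL2 := ContinuousMap.toLp 2 cantorMeasure ℂ (walsh S)

lemma inner_toLp (f g : C(CantorGroup, ℂ)) :
    inner ℂ (ContinuousMap.toLp 2 cantorMeasure ℂ f) (ContinuousMap.toLp 2 cantorMeasure ℂ g)
      = ∫ x, g x * (starRingEnd ℂ) (f x) ∂cantorMeasure :=
  ContinuousMap.inner_toLp cantorMeasure f g

lemma inner_walshVec (S R : Finset ℕ) :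
    inner ℂ (walshVec S) (walshVec R) = if S = R then (1 : ℂ) else 0 := by
  rw [walshVec, walshVec, inner_toLp]
  have : ∀ x, walsh R x * (starRingEnd ℂ) (walsh S x) = walsh (S ∆ R) x := by
    intro x
    rw [star_walsh_apply, ← walsh_mul, ContinuousMap.mul_apply, mul_comm]
  simp_rw [this]
  split_ifs with h
  · subst h
    simp
  · refine integral_walsh ?_
    rw [Finset.nonempty_iff_ne_empty]
    intro h'
    exact h (symmDiff_eq_bot.1 h')

lemma orthonormal_walshVec : Orthonormal ℂ walshVec := by
  rw [orthonormal_iff_ite]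
  exact inner_walshVec

lemma walsh_mul_mem_span {s : Set (Finset ℕ)} (hs : ∀ S ∈ s, ∀ R ∈ s, S ∆ R ∈ s)
    {f g : C(CantorGroup, ℂ)} (hf : f ∈ Submodule.span ℂ (walsh '' s))
    (hg : g ∈ Submodule.span ℂ (walsh '' s)) : f * g ∈ Submodule.span ℂ (walsh '' s) := by
  have h := Submodule.mul_mem_mul hf hg
  rw [Submodule.span_mul_span] at h
  refine Submodule.span_mono ?_ h
  rintro _ ⟨_, ⟨S, hS, rfl⟩, _, ⟨R, hR, rfl⟩, rfl⟩
  exact ⟨_, hs S hS R hR, (walsh_mul S R).symm⟩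

/-- The linear span of the Walsh functions of a group of finite sets is a *-subalgebra. -/
def walshSubalgebra (s : Set (Finset ℕ)) (h0 : ∅ ∈ s) (hs : ∀ S ∈ s, ∀ R ∈ s, S ∆ R ∈ s) :
    StarSubalgebra ℂ C(CantorGroup, ℂ) where
  carrier := Submodule.span ℂ (walsh '' s)
  add_mem' := Submodule.add_mem _
  mul_mem' := walsh_mul_mem_span hs
  algebraMap_mem' c := by
    rw [Algebra.algebraMap_eq_smul_one, ← walsh_empty]
    exact Submodule.smul_mem _ _ (Submodule.subset_span ⟨_, h0, rfl⟩)
  star_mem' {f} hf := by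
    induction hf using Submodule.span_induction with
    | mem f hf =>
      obtain ⟨S, hS, rfl⟩ := hf
      rw [star_walsh]
      exact Submodule.subset_span ⟨S, hS, rfl⟩
    | zero => simp
    | add f g _ _ hf hg => rw [star_add]; exact Submodule.add_mem _ hf hg
    | smul c f _ hf => rw [star_smul]; exact Submodule.smul_mem _ _ hf

lemma walsh_singleton (i : ℕ) : walsh {i} = 1 - 2 * coordFun i := by simp [walsh]

lemma coordFun_eq (i : ℕ) :
    coordFun i = (1 / 2 : ℂ) • walsh ∅ - (1 / 2 : ℂ) • walsh {i} := by
  rw [walsh_singleton, walsh_empty]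
  ext x
  change coordFun i x = (1 / 2 : ℂ) * 1 - (1 / 2 : ℂ) * (1 - 2 * coordFun i x)
  ring

lemma coordFun_mem_span {s : Set (Finset ℕ)} (h0 : ∅ ∈ s) {i : ℕ} (hi : {i} ∈ s) :
    coordFun i ∈ Submodule.span ℂ (walsh '' s) := by
  rw [coordFun_eq]
  exact Submodule.sub_mem _ (Submodule.smul_mem _ _ (Submodule.subset_span ⟨_, h0, rfl⟩))
    (Submodule.smul_mem _ _ (Submodule.subset_span ⟨_, hi, rfl⟩))

/-- Stone–Weierstrass: the span is already a unital *-subalgebra, and it contains the coordinate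
functions, which separate points. -/
lemma dense_span_walsh : Dense (Submodule.span ℂ (Set.range walsh) : Set C(CantorGroup, ℂ)) := by
  have h := ContinuousMap.starSubalgebra_topologicalClosure_eq_top_of_separatesPoints
    (walshSubalgebra Set.univ trivial fun _ _ _ _ => trivial) (by
      intro x y hxy
      obtain ⟨i, hi⟩ := Function.ne_iff.1 hxy
      refine ⟨coordFun i, ⟨_, coordFun_mem_span (Set.mem_univ _) (Set.mem_univ _), rfl⟩, ?_⟩
      intro h
      apply hi
      have h' : ((x i).val : ℂ) = ((y i).val : ℂ) := h
      exact ZMod.val_injective 2 (by exact_mod_cast h'))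
  intro f
  have hf : f ∈ (⊤ : StarSubalgebra ℂ C(CantorGroup, ℂ)) := trivial
  rw [← h, ← SetLike.mem_coe, StarSubalgebra.topologicalClosure_coe] at hf
  rw [← Set.image_univ]
  exact hf

lemma span_walshVec_dense :
    ⊤ ≤ (Submodule.span ℂ (Set.range walshVec)).topologicalClosure := by
  intro ξ _
  have hd : DenseRange (ContinuousMap.toLp 2 cantorMeasure ℂ : C(CantorGroup, ℂ) →L[ℂ] CantorL2) :=
    ContinuousMap.toLp_denseRange ℂ cantorMeasure ℂ (by norm_num)
  have h1 := hd.dense_image (ContinuousMap.toLp 2 cantorMeasure ℂ :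
    C(CantorGroup, ℂ) →L[ℂ] CantorL2).continuous dense_span_walsh
  have h2 : (Submodule.span ℂ (Set.range walshVec) : Set CantorL2) =
      (ContinuousMap.toLp 2 cantorMeasure ℂ : C(CantorGroup, ℂ) →L[ℂ] CantorL2) ''
        (Submodule.span ℂ (Set.range walsh)) := by
    have : Set.range walshVec = (ContinuousMap.toLp 2 cantorMeasure ℂ :
      C(CantorGroup, ℂ) →L[ℂ] CantorL2).toLinearMap '' (Set.range walsh) := by
      rw [← Set.range_comp]; rfl
    rw [this, ← Submodule.map_span]
    rfl
  rw [← SetLike.mem_coe, Submodule.topologicalClosure_coe, h2]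
  exact h1 ξ

/-- The Walsh functions form a Hilbert basis of `L²`. -/
def walshBasis : HilbertBasis (Finset ℕ) ℂ CantorL2 :=
  HilbertBasis.mk orthonormal_walshVec span_walshVec_dense

@[simp] lemma walshBasis_apply (S : Finset ℕ) : walshBasis S = walshVec S := by
  simp [walshBasis]

/-- The Walsh coefficients of a vector. -/
def coef (S : Finset ℕ) : CantorL2 →L[ℂ] ℂ := innerSL ℂ (walshVec S)

lemma coef_apply (S : Finset ℕ) (ξ : CantorL2) : coef S ξ = inner ℂ (walshVec S) ξ := rfl

lemma coef_walshVec (S R : Finset ℕ) : coef S (walshVec R) = if S = R then 1 else 0 :=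
  inner_walshVec S R

lemma repr_eq_coef (ξ : CantorL2) (S : Finset ℕ) : walshBasis.repr ξ S = coef S ξ := by
  rw [HilbertBasis.repr_apply_apply, walshBasis_apply]; rfl

lemma ext_coef {ξ η : CantorL2} (h : ∀ S, coef S ξ = coef S η) : ξ = η := by
  apply walshBasis.repr.injective
  ext S
  rw [repr_eq_coef, repr_eq_coef, h]

lemma hasSum_coef (ξ : CantorL2) : HasSum (fun S => coef S ξ • walshVec S) ξ := by
  have := walshBasis.hasSum_repr ξ
  simpa [repr_eq_coef] using this

lemma hasSum_norm_coef_sq (ξ : CantorL2) : HasSum (fun S => ‖coef S ξ‖ ^ 2) (‖ξ‖ ^ 2) := by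
  have h := walshBasis.hasSum_inner_mul_inner ξ ξ
  have h2 := Complex.hasSum_re h
  have h3 : (inner ℂ ξ ξ : ℂ).re = ‖ξ‖ ^ 2 := inner_self_eq_norm_sq (𝕜 := ℂ) ξ
  rw [h3] at h2
  convert h2 using 2 with S
  rw [walshBasis_apply, ← coef_apply, ← inner_conj_symm, ← coef_apply, mul_comm,
    Complex.mul_conj, Complex.normSq_eq_norm_sq]
  rfl

/-- A square summable family is the family of Walsh coefficients of a vector. -/
lemma exists_coef_eq {c : Finset ℕ → ℂ} (hc : Summable fun S => ‖c S‖ ^ 2) :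
    ∃ ξ : CantorL2, ∀ S, coef S ξ = c S := by
  refine ⟨walshBasis.repr.symm ⟨c, memℓp_gen (by simpa using hc)⟩, fun S => ?_⟩
  rw [← repr_eq_coef, LinearIsometryEquiv.apply_symm_apply]

lemma mulOperator_toLp (f g : C(CantorGroup, ℂ)) :
    mulOperator f (ContinuousMap.toLp 2 cantorMeasure ℂ g)
      = ContinuousMap.toLp 2 cantorMeasure ℂ (f * g) := by
  refine Lp.ext ?_
  filter_upwards [coeFn_mulOperator f (ContinuousMap.toLp 2 cantorMeasure ℂ g),
    ContinuousMap.coeFn_toLp (p := 2) (𝕜 := ℂ) cantorMeasure g,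
    ContinuousMap.coeFn_toLp (p := 2) (𝕜 := ℂ) cantorMeasure (f * g)] with x h1 h2 h3
  rw [h1, h2, h3, ContinuousMap.mul_apply]

/-- The multiplication operators of the Walsh functions permute the Walsh functions. -/
lemma mulOperator_walshVec (S R : Finset ℕ) :
    mulOperator (walsh S) (walshVec R) = walshVec (S ∆ R) := by
  rw [walshVec, mulOperator_toLp, walsh_mul]; rfl

/-- The Walsh coefficients of a continuous function. -/
def walshCoef (S : Finset ℕ) (a : C(CantorGroup, ℂ)) : ℂ :=
  coef S (ContinuousMap.toLp 2 cantorMeasure ℂ a)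

lemma mulRep_apply (a : C(CantorGroup, ℂ)) : mulRep a = mulOperator a := rfl

lemma mulRep_mul_apply (a b : C(CantorGroup, ℂ)) (ξ : CantorL2) :
    mulRep (a * b) ξ = mulRep a (mulRep b ξ) := by
  rw [map_mul]; rfl

lemma mulRep_comm_apply (a b : C(CantorGroup, ℂ)) (ξ : CantorL2) :
    mulRep a (mulRep b ξ) = mulRep b (mulRep a ξ) := by
  rw [← mulRep_mul_apply, mul_comm, mulRep_mul_apply]

lemma coef_mulRep_walsh (S R : Finset ℕ) (ξ : CantorL2) :
    coef R (mulRep (walsh S) ξ) = coef (S ∆ R) ξ := by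
  rw [coef_apply, ← ContinuousLinearMap.adjoint_inner_left, ← ContinuousLinearMap.star_eq_adjoint,
    ← map_star, star_walsh, mulRep_apply, mulOperator_walshVec]
  rfl

lemma mulRep_walshVec (a : C(CantorGroup, ℂ)) (S : Finset ℕ) :
    mulRep a (walshVec S) = mulRep (walsh S) (ContinuousMap.toLp 2 cantorMeasure ℂ a) := by
  rw [mulRep_apply, mulRep_apply, walshVec, mulOperator_toLp, mulOperator_toLp, mul_comm]

lemma coef_mulRep_walshVec (a : C(CantorGroup, ℂ)) (R S : Finset ℕ) :
    coef R (mulRep a (walshVec S)) = walshCoef (S ∆ R) a := by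
  rw [mulRep_walshVec, coef_mulRep_walsh]; rfl

/-! ### Levels -/

/-- The number of the last coordinate (counted from `1`) on which the Walsh function depends. -/
def level (S : Finset ℕ) : ℕ := S.sup Nat.succ

lemma level_le_iff {S : Finset ℕ} {n : ℕ} : level S ≤ n ↔ S ⊆ Finset.range n := by
  simp [level, Finset.sup_le_iff, Finset.subset_iff]

@[simp] lemma level_empty : level ∅ = 0 := rfl

lemma level_eq_zero_iff {S : Finset ℕ} : level S = 0 ↔ S = ∅ := by
  rw [← Nat.le_zero, level_le_iff]; simp

lemma level_symmDiff_le (S R : Finset ℕ) : level (S ∆ R) ≤ max (level S) (level R) := by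
  rw [level_le_iff]
  have h1 : S ⊆ Finset.range (max (level S) (level R)) := level_le_iff.1 (le_max_left _ _)
  have h2 : R ⊆ Finset.range (max (level S) (level R)) := level_le_iff.1 (le_max_right _ _)
  intro i hi
  rcases Finset.mem_symmDiff.1 hi with h | h
  exacts [h1 h.1, h2 h.1]

/-- Since `R = S ∆ (S ∆ R)`, the level of `S ∆ R` cannot drop below that of `R` when `S` has smaller
level. -/
lemma level_symmDiff_of_lt {S R : Finset ℕ} (h : level S < level R) :
    level (S ∆ R) = level R := by
  apply le_antisymm ((level_symmDiff_le S R).trans (max_le h.le le_rfl))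
  have h1 := level_symmDiff_le S (S ∆ R)
  rw [symmDiff_symmDiff_cancel_left] at h1
  rcases le_max_iff.1 h1 with h2 | h2 <;> omega

lemma span_walsh_eq_levelAlgebra (n : ℕ) :
    (Subalgebra.toSubmodule (levelAlgebra n).toSubalgebra)
      = Submodule.span ℂ (walsh '' {S | level S ≤ n}) := by
  have hs : ∀ S ∈ {S | level S ≤ n}, ∀ R ∈ {S | level S ≤ n}, S ∆ R ∈ {S | level S ≤ n} :=
    fun S hS R hR => (level_symmDiff_le S R).trans (max_le hS hR)
  have h0 : ∅ ∈ {S | level S ≤ n} := Nat.zero_le n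
  apply le_antisymm
  · have : levelAlgebra n ≤ walshSubalgebra {S | level S ≤ n} h0 hs := by
      rw [levelAlgebra, StarAlgebra.adjoin_le_iff]
      rintro _ ⟨i, hi, rfl⟩
      have hi' : ({i} : Finset ℕ) ∈ {S | level S ≤ n} := by
        have : i < n := hi
        simp only [Set.mem_ofPred_eq, level, Finset.sup_singleton]
        omega
      exact coordFun_mem_span h0 hi'
    exact fun f hf => this hf
  · rw [Submodule.span_le]
    rintro _ ⟨S, hS, rfl⟩
    have : walsh S ∈ levelAlgebra n := by
      refine prod_mem fun i hi => ?_
      have hi' : i < n := Finset.mem_range.1 (level_le_iff.1 hS hi)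
      have h1 : coordFun i ∈ levelAlgebra n := StarAlgebra.subset_adjoin ℂ _ ⟨i, hi', rfl⟩
      have h2 : (2 : C(CantorGroup, ℂ)) ∈ levelAlgebra n := by
        have h3 : (2 : C(CantorGroup, ℂ)) = 1 + 1 := one_add_one_eq_two.symm
        rw [h3]; exact add_mem (one_mem _) (one_mem _)
      exact sub_mem (one_mem _) (mul_mem h2 h1)
    exact this

lemma levelSpace_eq_span (n : ℕ) :
    levelSpace n = Submodule.span ℂ (walshVec '' {S | level S ≤ n}) := by
  rw [levelSpace, span_walsh_eq_levelAlgebra, Submodule.map_span, ← Set.image_comp]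
  rfl

lemma starProjection_walshVec (n : ℕ) (S : Finset ℕ) :
    (levelSpace n).starProjection (walshVec S) = if level S ≤ n then walshVec S else 0 := by
  split_ifs with h
  · rw [Submodule.starProjection_eq_self_iff, levelSpace_eq_span]
    exact Submodule.subset_span ⟨S, h, rfl⟩
  · rw [Submodule.starProjection_apply_eq_zero_iff, levelSpace_eq_span, Submodule.mem_orthogonal]
    intro u hu
    induction hu using Submodule.span_induction with
    | mem u hu =>
      obtain ⟨R, hR, rfl⟩ := hu
      rw [inner_walshVec, if_neg]
      rintro rfl
      exact h hR
    | zero => simp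
    | add u v _ _ hu hv => rw [inner_add_left, hu, hv, add_zero]
    | smul c u _ hu => rw [inner_smul_left, hu, mul_zero]

lemma coef_starProjection (n : ℕ) (S : Finset ℕ) (ξ : CantorL2) :
    coef S ((levelSpace n).starProjection ξ) = if level S ≤ n then coef S ξ else 0 := by
  rw [coef_apply, ← Submodule.inner_starProjection_left_eq_right, starProjection_walshVec]
  split_ifs
  · rfl
  · simp

lemma coef_levelProj (n : ℕ) (S : Finset ℕ) (ξ : CantorL2) :
    coef S (levelProj n ξ) = if level S = n then coef S ξ else 0 := by
  cases n with
  | zero =>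
    rw [levelProj, coef_starProjection]
    simp only [Nat.le_zero]
  | succ n =>
    rw [levelProj, sub_apply, map_sub, coef_starProjection, coef_starProjection]
    by_cases h1 : level S ≤ n
    · rw [if_pos h1, if_pos (by omega), if_neg (by omega), sub_self]
    · by_cases h2 : level S = n + 1
      · rw [if_neg h1, if_pos (by omega), if_pos h2, sub_zero]
      · rw [if_neg h1, if_neg (by omega), if_neg h2, sub_zero]

/-! ### The Dirac operator in the Walsh basis -/

/-- The Walsh expansion of `η`, grouped along the fibres of `level`. -/
lemma hasSum_levelProj (η : CantorL2) : HasSum (fun n => levelProj n η) η := by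
  have h1 := (Equiv.sigmaFiberEquiv level).hasSum_iff.2 (hasSum_coef η)
  refine h1.sigma fun n => ?_
  have h2 := hasSum_coef (levelProj n η)
  have h3 : (fun S => coef S (levelProj n η) • walshVec S)
      = Set.indicator {S | level S = n} (fun S => coef S η • walshVec S) := by
    ext1 S
    rw [coef_levelProj, Set.indicator_apply]
    by_cases h : level S = n <;> simp [h]
  rw [h3, ← hasSum_subtype_iff_indicator] at h2
  exact h2

lemma coef_cantorDirac {α : ℕ → ℝ} (hα : α 0 = 0) {ξ : CantorL2}
    (h : ξ ∈ (cantorDirac α).domain) (S : Finset ℕ) :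
    coef S (cantorDirac α ⟨ξ, h⟩) = α (level S) * coef S ξ := by
  have h1 : HasSum (fun n : ℕ => (α (n + 1) : ℂ) • levelProj (n + 1) ξ) (cantorDirac α ⟨ξ, h⟩) :=
    Summable.hasSum h
  have h2 := (coef S).hasSum h1
  refine h2.unique ?_
  have h3 : ∀ n, coef S ((α (n + 1) : ℂ) • levelProj (n + 1) ξ)
      = if level S = n + 1 then α (level S) * coef S ξ else 0 := by
    intro n
    rw [map_smul, coef_levelProj, smul_eq_mul]
    by_cases h : level S = n + 1 <;> simp [h]
  simp_rw [h3]
  rcases Nat.eq_zero_or_pos (level S) with h0 | h0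
  · rw [h0, hα]
    simp
  · have h4 : ∀ n, (if level S = n + 1 then (α (level S) * coef S ξ : ℂ) else 0)
        = if n = level S - 1 then (α (level S) * coef S ξ : ℂ) else 0 := by
      intro n
      congr 1
      exact propext (by omega)
    simp_rw [h4]
    exact hasSum_ite_eq _ _

/-- The working criterion for the domain: the terms of the series for `D ξ` are the vectors
`levelProj (n + 1) η`, and these are summable for every `η`. -/
lemma mem_domain_cantorDirac {α : ℕ → ℝ} {ξ η : CantorL2}
    (h : ∀ S, coef S η = α (level S) * coef S ξ) : ξ ∈ (cantorDirac α).domain := by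
  have h1 : ∀ n : ℕ, (α (n + 1) : ℂ) • levelProj (n + 1) ξ = levelProj (n + 1) η := by
    intro n
    refine ext_coef fun S => ?_
    rw [map_smul, coef_levelProj, coef_levelProj, h, smul_eq_mul]
    by_cases h : level S = n + 1 <;> simp [h]
  change Summable fun n : ℕ => (α (n + 1) : ℂ) • levelProj (n + 1) ξ
  simp_rw [h1]
  exact (summable_nat_add_iff (f := fun n => levelProj n η) 1).2 (hasSum_levelProj η).summable

lemma cantorDirac_eq {α : ℕ → ℝ} (hα : α 0 = 0) {ξ η : CantorL2}
    (h : ∀ S, coef S η = α (level S) * coef S ξ) (hξ : ξ ∈ (cantorDirac α).domain) :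
    cantorDirac α ⟨ξ, hξ⟩ = η :=
  ext_coef fun S => by rw [coef_cantorDirac hα, h]

lemma coef_smul_walshVec (α : ℕ → ℝ) (R S : Finset ℕ) :
    coef S ((α (level R) : ℂ) • walshVec R) = α (level S) * coef S (walshVec R) := by
  rw [map_smul, coef_walshVec, smul_eq_mul]
  by_cases h : S = R <;> simp [h]

lemma walshVec_mem_domain (α : ℕ → ℝ) (R : Finset ℕ) :
    walshVec R ∈ (cantorDirac α).domain :=
  mem_domain_cantorDirac (coef_smul_walshVec α R)

lemma cantorDirac_walshVec {α : ℕ → ℝ} (hα : α 0 = 0) (R : Finset ℕ) :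
    cantorDirac α ⟨walshVec R, walshVec_mem_domain α R⟩ = (α (level R) : ℂ) • walshVec R :=
  cantorDirac_eq hα (coef_smul_walshVec α R) _

lemma dense_submodule_of_walshVec_mem {V : Submodule ℂ CantorL2} (h : ∀ S, walshVec S ∈ V) :
    Dense (V : Set CantorL2) := by
  have h1 : Dense (Submodule.span ℂ (Set.range walshVec) : Set CantorL2) := by
    intro ξ
    have := span_walshVec_dense (x := ξ) trivial
    rwa [← SetLike.mem_coe, Submodule.topologicalClosure_coe] at this
  refine h1.mono (Submodule.span_le.2 ?_)
  rintro _ ⟨S, rfl⟩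
  exact h S

lemma dense_domain_cantorDirac (α : ℕ → ℝ) : Dense ((cantorDirac α).domain : Set CantorL2) :=
  dense_submodule_of_walshVec_mem (walshVec_mem_domain α)

lemma inner_eq_tsum_coef (ξ η : CantorL2) :
    HasSum (fun S => (starRingEnd ℂ) (coef S ξ) * coef S η) (inner ℂ ξ η) := by
  have h := walshBasis.hasSum_inner_mul_inner ξ η
  have h' : (fun S => (starRingEnd ℂ) (coef S ξ) * coef S η)
      = fun S => inner ℂ ξ (walshBasis S) * inner ℂ (walshBasis S) η := by
    ext1 S
    rw [walshBasis_apply, ← coef_apply, coef_apply S ξ, inner_conj_symm]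
  rw [h']
  exact h

lemma isSelfAdjoint_cantorDirac {α : ℕ → ℝ} (hα : α 0 = 0) : IsSelfAdjoint (cantorDirac α) := by
  rw [LinearPMap.isSelfAdjoint_def]
  have hd := dense_domain_cantorDirac α
  refine le_antisymm ?_ (LinearPMap.IsFormalAdjoint.le_adjoint hd ?_)
  -- Pairing the adjoint with Walsh vectors determines its coefficients, and the criterion above
  -- then puts its domain inside that of `D`.
  · have key : ∀ (η : (cantorDirac α).adjoint.domain) (S : Finset ℕ),
        coef S ((cantorDirac α).adjoint η) = α (level S) * coef S (η : CantorL2) := by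
      intro η S
      have h := LinearPMap.adjoint_isFormalAdjoint hd η ⟨walshVec S, walshVec_mem_domain α S⟩
      rw [cantorDirac_walshVec hα, inner_smul_right] at h
      have h' := congrArg (starRingEnd ℂ) h
      rw [map_mul, Complex.conj_ofReal, inner_conj_symm, inner_conj_symm] at h'
      exact h'
    refine ⟨fun η hη => mem_domain_cantorDirac (key ⟨η, hη⟩), fun η ζ h => ?_⟩
    obtain ⟨ζ, hζ⟩ := ζ
    obtain rfl : (η : CantorL2) = ζ := h
    exact (cantorDirac_eq hα (key η) hζ).symm
  · intro ξ η
    refine (inner_eq_tsum_coef _ _).unique ?_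
    convert inner_eq_tsum_coef (ξ : CantorL2) (cantorDirac α η) using 2 with S
    rw [coef_cantorDirac hα ξ.2, coef_cantorDirac hα η.2, map_mul, Complex.conj_ofReal]
    ring

/-! ### The resolvent -/

lemma norm_levelProj_le (n : ℕ) : ‖levelProj n‖ ≤ 1 := by
  refine ContinuousLinearMap.opNorm_le_bound _ zero_le_one fun ξ => ?_
  rw [one_mul]
  refine le_of_sq_le_sq ?_ (norm_nonneg _)
  refine hasSum_le (fun S => ?_) (hasSum_norm_coef_sq _) (hasSum_norm_coef_sq ξ)
  rw [coef_levelProj]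
  split_ifs
  · exact le_rfl
  · simp

lemma isCompactOperator_levelProj (n : ℕ) : IsCompactOperator (levelProj n) := by
  have h : ∀ n, IsCompactOperator (levelSpace n).starProjection := by
    intro n
    have : ProperSpace (levelSpace n) := FiniteDimensional.proper ℂ _
    have : IsCompactOperator (levelSpace n).orthogonalProjectionOnto :=
      isCompactOperator_of_locallyCompactSpace_dom _
    exact this.clm_comp (levelSpace n).subtypeL
  cases n with
  | zero => exact h 0
  | succ n => exact (h (n + 1)).sub (h n)

/-- The bounded operator `∑ c n • Q n` for a summable sequence `c`. -/
def levelDiagonal (c : ℕ → ℝ) : CantorL2 →L[ℂ] CantorL2 := ∑' n, (c n : ℂ) • levelProj n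

lemma summable_smul_levelProj {c : ℕ → ℝ} (hc : Summable c) :
    Summable fun n => (c n : ℂ) • levelProj n := by
  refine Summable.of_norm_bounded hc.abs fun n => ?_
  rw [norm_smul, Complex.norm_real, Real.norm_eq_abs]
  exact mul_le_of_le_one_right (abs_nonneg _) (norm_levelProj_le n)

lemma coef_levelDiagonal {c : ℕ → ℝ} (hc : Summable c) (S : Finset ℕ) (ξ : CantorL2) :
    coef S (levelDiagonal c ξ) = c (level S) * coef S ξ := by
  have h1 := (summable_smul_levelProj hc).hasSum
  have h2 := (coef S).hasSum ((ContinuousLinearMap.apply ℂ CantorL2 ξ).hasSum h1)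
  refine h2.unique ?_
  have h3 : ∀ n, coef S ((c n : ℂ) • levelProj n ξ)
      = if n = level S then c (level S) * coef S ξ else 0 := by
    intro n
    rw [map_smul, coef_levelProj, smul_eq_mul]
    by_cases h : level S = n
    · simp [h]
    · simp [h, Ne.symm h]
  convert hasSum_ite_eq (level S) (c (level S) * coef S ξ : ℂ) using 2 with n
  exact h3 n

/-- Summability of `c` makes the series converge in operator norm, so the sum is a norm limit of
finite-rank operators. -/
lemma isCompactOperator_levelDiagonal {c : ℕ → ℝ} (hc : Summable c) :
    IsCompactOperator (levelDiagonal c) := by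
  have h1 := (summable_smul_levelProj hc).hasSum.tendsto_sum_nat
  refine isClosed_setOfPred_isCompactOperator.mem_of_tendsto h1 (Filter.Eventually.of_forall ?_)
  intro n
  refine Finset.sum_induction _ (fun T : CantorL2 →L[ℂ] CantorL2 => IsCompactOperator T)
    (fun _ _ h h' => h.add h') isCompactOperator_zero fun i _ => ?_
  exact (isCompactOperator_levelProj i).smul (c i : ℂ)

lemma isInverseOneAddSq_levelDiagonal {α : ℕ → ℝ} (hα : α 0 = 0)
    (hc : Summable fun n => (1 + α n ^ 2)⁻¹) :
    IsInverseOneAddSq (cantorDirac α) (levelDiagonal fun n => (1 + α n ^ 2)⁻¹) := by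
  set R := levelDiagonal fun n => (1 + α n ^ 2)⁻¹ with hR
  have hpos : ∀ n, (1 + (α n : ℂ) ^ 2) ≠ 0 := by
    intro n
    have h : (0 : ℝ) < 1 + α n ^ 2 := by positivity
    exact_mod_cast h.ne'
  -- The last two bounds make `D R` and `D² R` everywhere defined, where `R` is the candidate
  -- inverse.
  have hb : ∀ t : ℝ, (1 + t ^ 2)⁻¹ ≤ 1 ∧ |t * (1 + t ^ 2)⁻¹| ≤ 1 ∧ |t ^ 2 * (1 + t ^ 2)⁻¹| ≤ 1 := by
    intro t
    have h : (0 : ℝ) < 1 + t ^ 2 := by positivity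
    refine ⟨inv_le_one_of_one_le₀ (by nlinarith), ?_, ?_⟩
    · rw [abs_mul, abs_of_pos (inv_pos.2 h), ← div_eq_mul_inv, div_le_one h, abs_le]
      constructor <;> nlinarith [sq_nonneg (t - 1), sq_nonneg (t + 1)]
    · rw [abs_mul, abs_of_pos (inv_pos.2 h), ← div_eq_mul_inv, div_le_one h, abs_of_nonneg (sq_nonneg t)]
      linarith
  have hex : ∀ (f : ℕ → ℝ) (_ : ∀ n, |f n| ≤ 1) (ξ : CantorL2),
      ∃ η, ∀ S, coef S η = f (level S) * coef S ξ := by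
    intro f hf ξ
    refine exists_coef_eq (Summable.of_nonneg_of_le (fun S => by positivity) (fun S => ?_)
      (hasSum_norm_coef_sq ξ).summable)
    rw [norm_mul, Complex.norm_real, Real.norm_eq_abs]
    gcongr
    exact mul_le_of_le_one_left (norm_nonneg _) (hf _)
  have hcoef : ∀ S ξ, coef S (R ξ) = (1 + (α (level S) : ℂ) ^ 2)⁻¹ * coef S ξ := by
    intro S ξ
    rw [hR, coef_levelDiagonal hc]
    push_cast
    rfl
  constructor
  · intro ξ
    obtain ⟨η, hη⟩ := hex (fun n => α n * (1 + α n ^ 2)⁻¹) (fun n => (hb _).2.1) ξ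
    obtain ⟨ζ, hζ⟩ := hex (fun n => α n ^ 2 * (1 + α n ^ 2)⁻¹) (fun n => (hb _).2.2) ξ
    have h1 : ∀ S, coef S η = α (level S) * coef S (R ξ) := by
      intro S
      rw [hη, hcoef]; push_cast; ring
    have h2 : ∀ S, coef S ζ = α (level S) * coef S η := by
      intro S
      rw [hη, hζ]; push_cast; ring
    have h3 := cantorDirac_eq hα h1 (mem_domain_cantorDirac h1)
    refine ⟨mem_domain_cantorDirac h1, by rw [h3]; exact mem_domain_cantorDirac h2, ?_⟩
    refine ext_coef fun S => ?_
    rw [map_add, coef_cantorDirac hα, coef_cantorDirac hα, hcoef]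
    have := hpos (level S)
    field_simp
  · intro ξ h h'
    refine ext_coef fun S => ?_
    rw [hcoef, map_add, coef_cantorDirac hα, coef_cantorDirac hα]
    have := hpos (level S)
    field_simp

lemma IsInverseOneAddSq.unique {H : Type*} [NormedAddCommGroup H] [InnerProductSpace ℂ H]
    {D : H →ₗ.[ℂ] H} {R R' : H →L[ℂ] H} (h : IsInverseOneAddSq D R) (h' : IsInverseOneAddSq D R') :
    R = R' := by
  ext ξ
  obtain ⟨h1, h2, h3⟩ := h'.right_inv ξ
  have := h.left_inv (R' ξ) h1 h2
  rwa [h3] at this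

/-! ### Commutators with the Dirac operator -/

/-- The diagonal operator `M⁻¹ D M - D`, where `M` is multiplication by a Walsh function. -/
def walshShift (α : ℕ → ℝ) (S : Finset ℕ) : CantorL2 →L[ℂ] CantorL2 :=
  ∑ R ∈ (Finset.range (level S)).powerset,
    ((α (level (S ∆ R)) : ℂ) - α (level R)) • (coef R).smulRight (walshVec R)

lemma coef_walshShift (α : ℕ → ℝ) (S R : Finset ℕ) (ξ : CantorL2) :
    coef R (walshShift α S ξ) = ((α (level (S ∆ R)) : ℂ) - α (level R)) * coef R ξ := by
  have h1 : coef R (walshShift α S ξ) = ∑ K ∈ (Finset.range (level S)).powerset,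
      if R = K then ((α (level (S ∆ R)) : ℂ) - α (level R)) * coef R ξ else 0 := by
    rw [walshShift, sum_apply, map_sum]
    refine Finset.sum_congr rfl fun K _ => ?_
    change coef R (((α (level (S ∆ K)) : ℂ) - α (level K)) • (coef K ξ • walshVec K)) = _
    rw [map_smul, map_smul, coef_walshVec, smul_eq_mul, smul_eq_mul]
    by_cases h : R = K
    · subst h; simp
    · simp [h]
  rw [h1, Finset.sum_ite_eq]
  split_ifs with h
  · rfl
  · rw [Finset.mem_powerset, ← level_le_iff, not_le] at h
    -- Beyond the level of `S`, multiplication by `walsh S` does not change levels; this is why a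
    -- finite sum suffices in `walshShift`.
    rw [level_symmDiff_of_lt h, sub_self, zero_mul]

lemma cantorDirac_mulRep_walsh {α : ℕ → ℝ} (hα : α 0 = 0) (S : Finset ℕ) {ξ : CantorL2}
    (h : ξ ∈ (cantorDirac α).domain) :
    ∃ h' : mulRep (walsh S) ξ ∈ (cantorDirac α).domain, cantorDirac α ⟨mulRep (walsh S) ξ, h'⟩
      = mulRep (walsh S) (cantorDirac α ⟨ξ, h⟩ + walshShift α S ξ) := by
  have key : ∀ R, coef R (mulRep (walsh S) (cantorDirac α ⟨ξ, h⟩ + walshShift α S ξ))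
      = α (level R) * coef R (mulRep (walsh S) ξ) := by
    intro R
    rw [coef_mulRep_walsh, coef_mulRep_walsh, map_add, coef_cantorDirac hα, coef_walshShift,
      symmDiff_symmDiff_cancel_left]
    ring
  exact ⟨mem_domain_cantorDirac key, cantorDirac_eq hα key _⟩

/-- A function which preserves the domain of the Dirac operator, with commutator `T` there. -/
def IsDomainCommutator (α : ℕ → ℝ) (a : C(CantorGroup, ℂ)) (T : CantorL2 →L[ℂ] CantorL2) : Prop :=
  ∀ (ξ : CantorL2) (h : ξ ∈ (cantorDirac α).domain),
    ∃ h' : mulRep a ξ ∈ (cantorDirac α).domain,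
      T ξ = cantorDirac α ⟨mulRep a ξ, h'⟩ - mulRep a (cantorDirac α ⟨ξ, h⟩)

lemma IsDomainCommutator.isCommutatorExtension {α : ℕ → ℝ} {a : C(CantorGroup, ℂ)}
    {T : CantorL2 →L[ℂ] CantorL2} (h : IsDomainCommutator α a T) :
    IsCommutatorExtension (cantorDirac α) (mulRep a) T where
  dense_domain := (dense_domain_cantorDirac α).mono fun ξ hξ => ⟨hξ, (h ξ hξ).1⟩
  eq_commutator ξ hξ _ := (h ξ hξ).2

lemma isDomainCommutator_zero (α : ℕ → ℝ) : IsDomainCommutator α 0 0 := by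
  intro ξ h
  have h0 : mulRep (0 : C(CantorGroup, ℂ)) ξ = 0 := by rw [map_zero]; rfl
  refine ⟨h0 ▸ Submodule.zero_mem _, ?_⟩
  have h1 : mulRep (0 : C(CantorGroup, ℂ)) (cantorDirac α ⟨ξ, h⟩) = 0 := by rw [map_zero]; rfl
  rw [h1, sub_zero]
  exact ((cantorDirac α).map_zero.symm.trans (by congr 1; exact Subtype.ext h0.symm))

lemma IsDomainCommutator.add {α : ℕ → ℝ} {a b : C(CantorGroup, ℂ)}
    {T U : CantorL2 →L[ℂ] CantorL2} (h : IsDomainCommutator α a T)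
    (h' : IsDomainCommutator α b U) : IsDomainCommutator α (a + b) (T + U) := by
  intro ξ hξ
  obtain ⟨h1, h2⟩ := h ξ hξ
  obtain ⟨h1', h2'⟩ := h' ξ hξ
  have h3 : ∀ η, mulRep (a + b) η = mulRep a η + mulRep b η := fun η => by rw [map_add]; rfl
  refine ⟨by rw [h3]; exact Submodule.add_mem _ h1 h1', ?_⟩
  have h4 : cantorDirac α ⟨mulRep (a + b) ξ, by rw [h3]; exact Submodule.add_mem _ h1 h1'⟩
      = cantorDirac α ⟨mulRep a ξ, h1⟩ + cantorDirac α ⟨mulRep b ξ, h1'⟩ := by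
    rw [← LinearPMap.map_add]
    congr 1
    exact Subtype.ext (h3 ξ)
  rw [h4, h3, add_apply, h2, h2']
  abel

lemma IsDomainCommutator.smul {α : ℕ → ℝ} {a : C(CantorGroup, ℂ)}
    {T : CantorL2 →L[ℂ] CantorL2} (h : IsDomainCommutator α a T) (c : ℂ) :
    IsDomainCommutator α (c • a) (c • T) := by
  intro ξ hξ
  obtain ⟨h1, h2⟩ := h ξ hξ
  have h3 : ∀ η, mulRep (c • a) η = c • mulRep a η := fun η => by rw [map_smul]; rfl
  refine ⟨by rw [h3]; exact Submodule.smul_mem _ c h1, ?_⟩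
  have h4 : cantorDirac α ⟨mulRep (c • a) ξ, by rw [h3]; exact Submodule.smul_mem _ c h1⟩
      = c • cantorDirac α ⟨mulRep a ξ, h1⟩ := by
    rw [← LinearPMap.map_smul]
    congr 1
    exact Subtype.ext (h3 ξ)
  rw [h4, h3, ← smul_sub, ← h2]
  rfl

lemma isDomainCommutator_walsh {α : ℕ → ℝ} (hα : α 0 = 0) (S : Finset ℕ) :
    IsDomainCommutator α (walsh S) (mulRep (walsh S) ∘L walshShift α S) := by
  intro ξ h
  obtain ⟨h1, h2⟩ := cantorDirac_mulRep_walsh hα S h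
  refine ⟨h1, ?_⟩
  rw [h2, map_add, add_sub_cancel_left]
  rfl

lemma norm_le_of_coef_le {ξ η : CantorL2} {C : ℝ} (hC : 0 ≤ C)
    (h : ∀ S, ‖coef S η‖ ≤ C * ‖coef S ξ‖) : ‖η‖ ≤ C * ‖ξ‖ := by
  refine le_of_sq_le_sq ?_ (by positivity)
  rw [mul_pow]
  refine hasSum_le (fun S => ?_) (hasSum_norm_coef_sq η) ((hasSum_norm_coef_sq ξ).mul_left (C ^ 2))
  rw [← mul_pow]
  exact pow_le_pow_left₀ (norm_nonneg _) (h S) 2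

lemma norm_mulRep_walsh (S : Finset ℕ) (ξ : CantorL2) : ‖mulRep (walsh S) ξ‖ ≤ ‖ξ‖ := by
  have h1 := (hasSum_norm_coef_sq ξ)
  have h2 := hasSum_norm_coef_sq (mulRep (walsh S) ξ)
  simp_rw [coef_mulRep_walsh] at h2
  have h3 := (symmDiff_right_involutive S).toPerm.hasSum_iff.2 h1
  have h4 := h3.unique h2
  exact le_of_sq_le_sq h4.ge (norm_nonneg _)

lemma norm_walsh_commutator_le {α : ℕ → ℝ} {S : Finset ℕ} {C : ℝ} (hC : 0 ≤ C)
    (h : ∀ R, |α (level (S ∆ R)) - α (level R)| ≤ C) :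
    ‖mulRep (walsh S) ∘L walshShift α S‖ ≤ C := by
  refine ContinuousLinearMap.opNorm_le_bound _ hC fun ξ => ?_
  refine (norm_mulRep_walsh S _).trans (norm_le_of_coef_le hC fun R => ?_)
  change ‖coef R (walshShift α S ξ)‖ ≤ _
  rw [coef_walshShift, norm_mul, ← Complex.ofReal_sub, Complex.norm_real]
  exact mul_le_mul_of_nonneg_right (h R) (norm_nonneg _)

lemma exists_isDomainCommutator {α : ℕ → ℝ} (hα : α 0 = 0) {a : C(CantorGroup, ℂ)}
    (ha : a ∈ Submodule.span ℂ (Set.range walsh)) : ∃ T, IsDomainCommutator α a T := by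
  induction ha using Submodule.span_induction with
  | mem a ha =>
    obtain ⟨S, rfl⟩ := ha
    exact ⟨_, isDomainCommutator_walsh hα S⟩
  | zero => exact ⟨_, isDomainCommutator_zero α⟩
  | add a b _ _ ha hb =>
    obtain ⟨T, hT⟩ := ha
    obtain ⟨U, hU⟩ := hb
    exact ⟨_, hT.add hU⟩
  | smul c a _ ha =>
    obtain ⟨T, hT⟩ := ha
    exact ⟨_, hT.smul c⟩

/-! ### The matrix of a bounded commutator -/

section Commutator

variable {α : ℕ → ℝ} {a : C(CantorGroup, ℂ)} {T : CantorL2 →L[ℂ] CantorL2}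

/-- Conjugation of a commutator by a Walsh function. -/
lemma IsCommutatorExtension.apply_mulRep_walsh (hα : α 0 = 0)
    (h : IsCommutatorExtension (cantorDirac α) (mulRep a) T) (S : Finset ℕ) (ξ : CantorL2) :
    T (mulRep (walsh S) ξ) = mulRep (walsh S)
      (T ξ + walshShift α S (mulRep a ξ) - mulRep a (walshShift α S ξ)) := by
  have hd : (fun ξ => T (mulRep (walsh S) ξ)) = fun ξ => mulRep (walsh S)
      (T ξ + walshShift α S (mulRep a ξ) - mulRep a (walshShift α S ξ)) := by
    -- Both sides are continuous, so the identity is needed only on the commutator domain.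
    -- Multiplication by `walsh S` preserves that domain, since it preserves `dom D` and commutes
    -- with `a`.
    refine Continuous.ext_on h.dense_domain (by fun_prop) (by fun_prop) ?_
    rintro ξ ⟨h1, h2⟩
    obtain ⟨h3, h4⟩ := cantorDirac_mulRep_walsh hα S h1
    obtain ⟨h5, h6⟩ := cantorDirac_mulRep_walsh hα S h2
    have h7 : mulRep a (mulRep (walsh S) ξ) ∈ (cantorDirac α).domain := by
      rw [mulRep_comm_apply]; exact h5
    have h8 : cantorDirac α ⟨mulRep a (mulRep (walsh S) ξ), h7⟩
        = cantorDirac α ⟨mulRep (walsh S) (mulRep a ξ), h5⟩ := by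
      congr 1
      exact Subtype.ext (mulRep_comm_apply _ _ _)
    change T (mulRep (walsh S) ξ) = mulRep (walsh S)
      (T ξ + walshShift α S (mulRep a ξ) - mulRep a (walshShift α S ξ))
    rw [h.eq_commutator _ h3 h7, h8, h6, h4, h.eq_commutator ξ h1 h2, mulRep_comm_apply a,
      ← map_sub, map_add (mulRep a)]
    congr 1
    abel
  exact congrFun hd ξ

/-- The part of the matrix of `T` which is not accounted for by the matrix of the commutator. -/
def commutatorDefect (α : ℕ → ℝ) (a : C(CantorGroup, ℂ)) (T : CantorL2 →L[ℂ] CantorL2)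
    (R S : Finset ℕ) : ℂ :=
  coef R (T (walshVec S)) - ((α (level R) : ℂ) - α (level S)) * walshCoef (S ∆ R) a

lemma walshShift_walshVec (α : ℕ → ℝ) (S R : Finset ℕ) :
    walshShift α S (walshVec R) = ((α (level (S ∆ R)) : ℂ) - α (level R)) • walshVec R := by
  refine ext_coef fun K => ?_
  rw [coef_walshShift, map_smul, coef_walshVec, smul_eq_mul]
  by_cases h : K = R
  · subst h; rfl
  · simp [h]

/-- The conjugation identity read entrywise: the two shift terms are exactly the change in `α (level
R) - α (level S)`, so the defect is translation invariant. -/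
lemma IsCommutatorExtension.commutatorDefect_symmDiff (hα : α 0 = 0)
    (h : IsCommutatorExtension (cantorDirac α) (mulRep a) T) (R S K : Finset ℕ) :
    commutatorDefect α a T R (S ∆ K) = commutatorDefect α a T (S ∆ R) K := by
  have h1 := congrArg (coef R) (h.apply_mulRep_walsh hα S (walshVec K))
  rw [coef_mulRep_walsh, map_sub, map_add, coef_walshShift, walshShift_walshVec, map_smul,
    map_smul, coef_mulRep_walshVec, symmDiff_symmDiff_cancel_left, smul_eq_mul] at h1
  rw [mulRep_apply, mulOperator_walshVec] at h1
  have h2 : K ∆ (S ∆ R) = (S ∆ K) ∆ R := by rw [symmDiff_comm S K, symmDiff_assoc]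
  rw [commutatorDefect, commutatorDefect, h1, h2]
  ring

lemma IsCommutatorExtension.commutatorDefect_eq (hα : α 0 = 0)
    (h : IsCommutatorExtension (cantorDirac α) (mulRep a) T) (R S : Finset ℕ) :
    commutatorDefect α a T R S = commutatorDefect α a T (S ∆ R) ∅ := by
  rw [← h.commutatorDefect_symmDiff hα]
  congr 1
  exact (symmDiff_bot S).symm

/-- By translation invariance any finitely many defects can be moved to a column `{n}` of high
level. There the relevant eigenvalues coincide, and the defects become plain matrix entries of the
bounded operator `T`. -/
lemma IsCommutatorExtension.summable_commutatorDefect (hα : α 0 = 0)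
    (h : IsCommutatorExtension (cantorDirac α) (mulRep a) T) :
    Summable fun S => ‖commutatorDefect α a T S ∅‖ ^ 2 := by
  refine summable_of_sum_le (c := ‖T‖ ^ 2) (fun S => by positivity) fun F => ?_
  -- The set `{n}` has level `n + 1`, strictly above every level occurring in `F`.
  set n := F.sup level with hn
  have hlev : level {n} = n + 1 := by simp [level]
  have h1 : ∀ S ∈ F, commutatorDefect α a T S ∅ = coef (S ∆ {n}) (T (walshVec {n})) := by
    intro S hS
    have h2 : level S < level {n} := by
      rw [hlev]
      exact Nat.lt_succ_of_le (Finset.le_sup (f := level) hS)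
    have h3 := h.commutatorDefect_eq hα (S ∆ {n}) {n}
    rw [symmDiff_comm S, symmDiff_symmDiff_cancel_left] at h3
    rw [← h3, commutatorDefect, symmDiff_comm _ S, level_symmDiff_of_lt h2, sub_self, zero_mul,
      sub_zero]
  rw [Finset.sum_congr rfl fun S hS => by rw [h1 S hS]]
  have hinj : Function.Injective fun S : Finset ℕ => S ∆ {n} := symmDiff_left_injective _
  have h4 := hasSum_norm_coef_sq (T (walshVec {n}))
  have h5 := h4.summable.sum_le_tsum (F.image fun S => S ∆ {n}) (fun S _ => by positivity)
  rw [Finset.sum_image fun _ _ _ _ hh => hinj hh, h4.tsum_eq] at h5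
  refine h5.trans ?_
  have h6 : ‖walshVec {n}‖ = 1 := orthonormal_walshVec.1 _
  have h7 := T.le_opNorm (walshVec {n})
  rw [h6, mul_one] at h7
  exact pow_le_pow_left₀ (norm_nonneg _) h7 2

/-- By square summability the conjugate defects are the coefficients of a vector `g`. The `∅`-row of
the commutator identity says that `g` is orthogonal to the dense commutator domain, so `g = 0`. -/
lemma IsCommutatorExtension.commutatorDefect_eq_zero (hα : α 0 = 0)
    (h : IsCommutatorExtension (cantorDirac α) (mulRep a) T) (S : Finset ℕ) :
    commutatorDefect α a T S ∅ = 0 := by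
  obtain ⟨g, hg⟩ := exists_coef_eq
    (c := fun S => (starRingEnd ℂ) (commutatorDefect α a T S ∅)) (by
      simpa using h.summable_commutatorDefect hα)
  have h1 : ∀ ξ, ξ ∈ {ξ : CantorL2 | ξ ∈ (cantorDirac α).domain ∧
      mulRep a ξ ∈ (cantorDirac α).domain} → (inner ℂ g ξ : ℂ) = 0 := by
    rintro ξ ⟨h2, h3⟩
    have h4 := (coef ∅ ∘L T).hasSum (hasSum_coef ξ)
    have h5 := (coef ∅ ∘L mulRep a).hasSum (hasSum_coef (cantorDirac α ⟨ξ, h2⟩))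
    have h6 := h4.add h5
    -- The `∅`-coefficient of `D (a ξ)` vanishes because `α 0 = 0`; this avoids expanding `a ξ`.
    have h7 : (coef ∅ ∘L T) ξ + (coef ∅ ∘L mulRep a) (cantorDirac α ⟨ξ, h2⟩) = 0 := by
      change coef ∅ (T ξ) + coef ∅ (mulRep a (cantorDirac α ⟨ξ, h2⟩)) = 0
      rw [h.eq_commutator ξ h2 h3, map_sub, sub_add_cancel, coef_cantorDirac hα, level_empty, hα]
      simp
    rw [h7] at h6
    refine (inner_eq_tsum_coef g ξ).unique ?_
    convert h6 using 2 with R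
    change _ = coef ∅ (T (coef R ξ • walshVec R))
      + coef ∅ (mulRep a (coef R (cantorDirac α ⟨ξ, h2⟩) • walshVec R))
    rw [map_smul, map_smul, map_smul, map_smul, coef_cantorDirac hα, coef_mulRep_walshVec, hg,
      Complex.conj_conj]
    have h8 := h.commutatorDefect_eq hα ∅ R
    have h9 : R ∆ ∅ = R := symmDiff_bot R
    rw [h9, commutatorDefect, h9, level_empty, hα] at h8
    rw [← h8, h9, smul_eq_mul, smul_eq_mul]
    push_cast
    ring
  have h2 : (fun ξ => (inner ℂ g ξ : ℂ)) = fun _ => 0 :=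
    Continuous.ext_on h.dense_domain (by fun_prop) continuous_const h1
  have h3 : g = 0 := inner_self_eq_zero.1 (congrFun h2 g)
  have h4 := hg S
  rw [h3, map_zero] at h4
  simpa using h4.symm

/-- The matrix of the commutator `[D, a]` in the Walsh basis. -/
theorem IsCommutatorExtension.coef_apply_walshVec (hα : α 0 = 0)
    (h : IsCommutatorExtension (cantorDirac α) (mulRep a) T) (R S : Finset ℕ) :
    coef R (T (walshVec S)) = ((α (level R) : ℂ) - α (level S)) * walshCoef (S ∆ R) a := by
  have h1 := h.commutatorDefect_eq hα R S
  rw [h.commutatorDefect_eq_zero hα] at h1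
  exact sub_eq_zero.1 h1

end Commutator

/-! ### Conditional expectations onto the level algebras -/

/-- The linear combination of the Walsh functions of level at most `n`. -/
def walshSum (n : ℕ) (c : Finset ℕ → ℂ) : CantorL2 :=
  ∑ S ∈ (Finset.range n).powerset, c S • walshVec S

lemma coef_walshSum (n : ℕ) (c : Finset ℕ → ℂ) (R : Finset ℕ) :
    coef R (walshSum n c) = if R ∈ (Finset.range n).powerset then c R else 0 := by
  rw [walshSum, map_sum, ← Finset.sum_ite_eq (Finset.range n).powerset R c]
  refine Finset.sum_congr rfl fun K _ => ?_
  rw [map_smul, coef_walshVec, smul_eq_mul]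
  split_ifs <;> simp

lemma inner_walshSum (n : ℕ) (c : Finset ℕ → ℂ) (η : CantorL2) :
    inner ℂ (walshSum n c) η
      = ∑ S ∈ (Finset.range n).powerset, (starRingEnd ℂ) (c S) * coef S η := by
  rw [walshSum, sum_inner]
  exact Finset.sum_congr rfl fun K _ => inner_smul_left _ _ _

/-- The reproducing kernel of `levelSpace n` at `x`. -/
def walshKernel (n : ℕ) (x : CantorGroup) : CantorL2 := walshSum n fun S => walsh S x

/-- The kernel is `2 ^ n` times the indicator of the cylinder of points agreeing with `x` in the
first `n` coordinates, a set of measure `2 ^ (-n)`. -/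
lemma norm_walshKernel_sq (n : ℕ) (x : CantorGroup) : ‖walshKernel n x‖ ^ 2 = 2 ^ n := by
  have h : (inner ℂ (walshKernel n x) (walshKernel n x) : ℂ) = ((2 ^ n : ℝ) : ℂ) := by
    rw [walshKernel, inner_walshSum]
    have : ∀ S ∈ (Finset.range n).powerset,
        (starRingEnd ℂ) (walsh S x) * coef S (walshSum n fun S => walsh S x) = 1 := by
      intro S hS
      rw [coef_walshSum, if_pos hS, star_walsh_apply]
      rcases walsh_eq_one_or S x with h | h <;> simp [h]
    rw [Finset.sum_congr rfl this]
    simp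
  rw [inner_self_eq_norm_sq_to_K] at h
  exact Complex.ofReal_injective (by rw [Complex.ofReal_pow]; exact h)

lemma walsh_symmDiff_apply (S R : Finset ℕ) (x : CantorGroup) :
    walsh (S ∆ R) x = walsh S x * walsh R x := by
  rw [← walsh_mul, ContinuousMap.mul_apply]

lemma symmDiff_mem_powerset {n : ℕ} {S R : Finset ℕ} (hS : S ∈ (Finset.range n).powerset)
    (hR : R ∈ (Finset.range n).powerset) : S ∆ R ∈ (Finset.range n).powerset := by
  rw [Finset.mem_powerset, ← level_le_iff] at *
  exact (level_symmDiff_le S R).trans (max_le hS hR)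

/-- The substitution `R ↦ R ∆ S` makes each summand of the outer sum independent of `S`; there are
`2 ^ n` of them. -/
lemma sum_sum_walsh (n : ℕ) (x : CantorGroup) (g : Finset ℕ → ℂ) :
    ∑ S ∈ (Finset.range n).powerset, walsh S x *
        ∑ R ∈ (Finset.range n).powerset, walsh R x * g (R ∆ S)
      = 2 ^ n * ∑ K ∈ (Finset.range n).powerset, walsh K x * g K := by
  have h : ∀ S ∈ (Finset.range n).powerset,
      walsh S x * ∑ R ∈ (Finset.range n).powerset, walsh R x * g (R ∆ S)
        = ∑ K ∈ (Finset.range n).powerset, walsh K x * g K := by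
    intro S hS
    rw [Finset.mul_sum]
    refine Finset.sum_nbij' (· ∆ S) (· ∆ S) (fun R hR => symmDiff_mem_powerset hR hS)
      (fun R hR => symmDiff_mem_powerset hR hS) (fun R _ => symmDiff_symmDiff_cancel_right _ _)
      (fun R _ => symmDiff_symmDiff_cancel_right _ _) fun R _ => ?_
    rw [walsh_symmDiff_apply]
    ring
  rw [Finset.sum_congr rfl h, Finset.sum_const, Finset.card_powerset, Finset.card_range,
    nsmul_eq_mul]
  push_cast
  rfl

/-- The conditional expectation of `C(∏ ℤ₂, ℂ)` onto `levelAlgebra n`. -/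
def levelExp (n : ℕ) (a : C(CantorGroup, ℂ)) : C(CantorGroup, ℂ) :=
  ∑ S ∈ (Finset.range n).powerset, walshCoef S a • walsh S

lemma levelExp_apply (n : ℕ) (a : C(CantorGroup, ℂ)) (x : CantorGroup) :
    levelExp n a x = ∑ S ∈ (Finset.range n).powerset, walsh S x * walshCoef S a := by
  rw [levelExp, ContinuousMap.sum_apply]
  exact Finset.sum_congr rfl fun S _ => mul_comm _ _

lemma coef_mulRep_walshSum (n : ℕ) (c : Finset ℕ → ℂ) (a : C(CantorGroup, ℂ)) (S : Finset ℕ) :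
    coef S (mulRep a (walshSum n c))
      = ∑ R ∈ (Finset.range n).powerset, c R * walshCoef (R ∆ S) a := by
  rw [walshSum, map_sum, map_sum]
  refine Finset.sum_congr rfl fun R _ => ?_
  rw [map_smul, map_smul, coef_mulRep_walshVec, smul_eq_mul]

lemma inner_walshKernel_mulRep (n : ℕ) (a : C(CantorGroup, ℂ)) (x : CantorGroup) :
    inner ℂ (walshKernel n x) (mulRep a (walshKernel n x)) = 2 ^ n * levelExp n a x := by
  rw [levelExp_apply, ← sum_sum_walsh n x (fun S => walshCoef S a), walshKernel, inner_walshSum]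
  refine Finset.sum_congr rfl fun S _ => ?_
  rw [coef_mulRep_walshSum, star_walsh_apply]

lemma insert_eq_symmDiff {n : ℕ} {K : Finset ℕ} (h : n ∉ K) : insert n K = K ∆ {n} := by
  ext i
  simp only [Finset.mem_insert, Finset.mem_symmDiff, Finset.mem_singleton]
  constructor
  · rintro (rfl | hi)
    · exact Or.inr ⟨rfl, h⟩
    · exact Or.inl ⟨hi, fun hh => h (hh ▸ hi)⟩
  · rintro (⟨hi, -⟩ | ⟨hi, -⟩)
    exacts [Or.inr hi, Or.inl hi]

lemma levelExp_succ_sub (n : ℕ) (a : C(CantorGroup, ℂ)) (x : CantorGroup) :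
    levelExp (n + 1) a x - levelExp n a x
      = walsh {n} x * ∑ K ∈ (Finset.range n).powerset, walsh K x * walshCoef (K ∆ {n}) a := by
  rw [levelExp_apply, levelExp_apply, Finset.range_add_one,
    Finset.sum_powerset_insert Finset.notMem_range_self, add_sub_cancel_left, Finset.mul_sum]
  refine Finset.sum_congr rfl fun K hK => ?_
  have h : n ∉ K := fun h => Finset.notMem_range_self (Finset.mem_powerset.1 hK h)
  rw [insert_eq_symmDiff h, walsh_symmDiff_apply]
  ring

/-- Expresses the pointwise increment as a matrix coefficient from levels at most `n` to level `n +
1`, where operator norm bounds apply. -/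
lemma inner_mulRep_walshKernel (n : ℕ) (a : C(CantorGroup, ℂ)) (x : CantorGroup) :
    inner ℂ (mulRep (walsh {n}) (walshKernel n x)) (mulRep a (walshKernel n x))
      = 2 ^ n * (walsh {n} x * (levelExp (n + 1) a x - levelExp n a x)) := by
  have h1 : walsh {n} x * walsh {n} x = 1 := by
    rcases walsh_eq_one_or {n} x with h | h <;> simp [h]
  rw [levelExp_succ_sub, ← mul_assoc (walsh {n} x), h1, one_mul,
    ← sum_sum_walsh n x (fun S => walshCoef (S ∆ {n}) a), ← ContinuousLinearMap.adjoint_inner_right,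
    ← ContinuousLinearMap.star_eq_adjoint, ← map_star, star_walsh]
  nth_rw 1 [walshKernel]
  rw [inner_walshSum]
  refine Finset.sum_congr rfl fun S _ => ?_
  rw [coef_mulRep_walsh, walshKernel, coef_mulRep_walshSum, star_walsh_apply]
  congr 1
  refine Finset.sum_congr rfl fun R _ => ?_
  rw [symmDiff_comm {n} S, symmDiff_assoc]

lemma norm_mulRep_le (a : C(CantorGroup, ℂ)) : ‖mulRep a‖ ≤ ‖a‖ :=
  NonUnitalStarAlgHom.norm_apply_le mulRep a

/-- The value `levelExp n a x` is the expectation of `a` in the normalised kernel vector at `x`, so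
Cauchy–Schwarz applies. -/
lemma norm_levelExp_le (n : ℕ) (a : C(CantorGroup, ℂ)) : ‖levelExp n a‖ ≤ ‖a‖ := by
  refine (ContinuousMap.norm_le _ (norm_nonneg _)).2 fun x => ?_
  have h1 : ‖(2 ^ n * levelExp n a x : ℂ)‖ ≤ 2 ^ n * ‖a‖ := by
    rw [← inner_walshKernel_mulRep, ← norm_walshKernel_sq n x]
    calc _ ≤ ‖walshKernel n x‖ * ‖mulRep a (walshKernel n x)‖ := norm_inner_le_norm _ _
      _ ≤ ‖walshKernel n x‖ * (‖a‖ * ‖walshKernel n x‖) := by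
        gcongr
        exact ContinuousLinearMap.le_of_opNorm_le _ (norm_mulRep_le a) _
      _ = _ := by ring
  rw [norm_mul, norm_pow, Complex.norm_ofNat] at h1
  exact le_of_mul_le_mul_left h1 (by positivity)

lemma walshCoef_walsh (S R : Finset ℕ) : walshCoef S (walsh R) = if S = R then 1 else 0 :=
  coef_walshVec S R

lemma walshCoef_add (S : Finset ℕ) (a b : C(CantorGroup, ℂ)) :
    walshCoef S (a + b) = walshCoef S a + walshCoef S b := by
  simp [walshCoef]

lemma walshCoef_smul (S : Finset ℕ) (c : ℂ) (a : C(CantorGroup, ℂ)) :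
    walshCoef S (c • a) = c * walshCoef S a := by
  simp [walshCoef]

lemma levelExp_add (n : ℕ) (a b : C(CantorGroup, ℂ)) :
    levelExp n (a + b) = levelExp n a + levelExp n b := by
  simp only [levelExp, walshCoef_add, add_smul, Finset.sum_add_distrib]

lemma levelExp_smul (n : ℕ) (c : ℂ) (a : C(CantorGroup, ℂ)) :
    levelExp n (c • a) = c • levelExp n a := by
  simp only [levelExp, walshCoef_smul, mul_smul, Finset.smul_sum]

lemma levelExp_sub (n : ℕ) (a b : C(CantorGroup, ℂ)) :
    levelExp n (a - b) = levelExp n a - levelExp n b := by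
  rw [sub_eq_add_neg, ← neg_one_smul ℂ b, levelExp_add, levelExp_smul, neg_one_smul,
    sub_eq_add_neg]

lemma levelExp_eventually_eq {a : C(CantorGroup, ℂ)}
    (ha : a ∈ Submodule.span ℂ (Set.range walsh)) : ∀ᶠ n in atTop, levelExp n a = a := by
  induction ha using Submodule.span_induction with
  | mem a ha =>
    obtain ⟨S, rfl⟩ := ha
    filter_upwards [eventually_ge_atTop (level S)] with n hn
    rw [levelExp, Finset.sum_eq_single_of_mem S (Finset.mem_powerset.2 (level_le_iff.1 hn))]
    · simp [walshCoef_walsh]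
    · intro R _ hR
      simp [walshCoef_walsh, hR]
  | zero => exact Eventually.of_forall fun n => by simpa using levelExp_smul n 0 0
  | add a b _ _ ha hb =>
    filter_upwards [ha, hb] with n h1 h2
    rw [levelExp_add, h1, h2]
  | smul c a _ ha =>
    filter_upwards [ha] with n h1
    rw [levelExp_smul, h1]

/-- The maps `levelExp n` are contractions that eventually fix every element of a dense subspace. -/
lemma tendsto_levelExp (a : C(CantorGroup, ℂ)) :
    Tendsto (fun n => levelExp n a) atTop (𝓝 a) := by
  rw [Metric.tendsto_atTop']
  intro ε hε
  obtain ⟨b, hb, hab⟩ := Metric.dense_iff.1 dense_span_walsh a (ε / 2) (by positivity)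
  rw [Metric.mem_ball, dist_comm, dist_eq_norm] at hb
  obtain ⟨N, hN⟩ := eventually_atTop.1 (levelExp_eventually_eq hab)
  refine ⟨N, fun n hn => ?_⟩
  have h1 : levelExp n a - a = levelExp n (a - b) - (a - b) := by
    rw [levelExp_sub, hN n hn.le]; abel
  rw [dist_eq_norm, h1]
  calc _ ≤ ‖levelExp n (a - b)‖ + ‖a - b‖ := norm_sub_le _ _
    _ ≤ ‖a - b‖ + ‖a - b‖ := by gcongr; exact norm_levelExp_le _ _
    _ < ε := by linarith

/-! ### Estimates from the growth condition -/

/-- `sup {|α (n + 1) - α i|⁻¹ : i ≤ n}`. -/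
def gapSup (α : ℕ → ℝ) (n : ℕ) : ℝ :=
  (⨆ (i : ℕ) (_ : i ≤ n), (ENNReal.ofReal |α (n + 1) - α i|)⁻¹).toReal

section Growth

variable {α : ℕ → ℝ}

lemma GrowthCondition.summable_gapSup (hg : GrowthCondition α) : Summable (gapSup α) :=
  ENNReal.summable_toReal hg.ne

lemma gapSup_nonneg (α : ℕ → ℝ) (n : ℕ) : 0 ≤ gapSup α n := ENNReal.toReal_nonneg

lemma GrowthCondition.gap (hg : GrowthCondition α) {n i : ℕ} (hi : i ≤ n) :
    α (n + 1) - α i ≠ 0 ∧ |α (n + 1) - α i|⁻¹ ≤ gapSup α n := by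
  have h1 : (⨆ (i : ℕ) (_ : i ≤ n), (ENNReal.ofReal |α (n + 1) - α i|)⁻¹) ≠ ∞ :=
    ENNReal.ne_top_of_tsum_ne_top hg.ne n
  have h2 : (ENNReal.ofReal |α (n + 1) - α i|)⁻¹
      ≤ ⨆ (i : ℕ) (_ : i ≤ n), (ENNReal.ofReal |α (n + 1) - α i|)⁻¹ :=
    le_iSup₂ (f := fun i (_ : i ≤ n) => (ENNReal.ofReal |α (n + 1) - α i|)⁻¹) i hi
  have h3 : 0 < |α (n + 1) - α i| := by
    by_contra h
    rw [ENNReal.ofReal_of_nonpos (not_lt.1 h), ENNReal.inv_zero, top_le_iff] at h2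
    exact h1 h2
  refine ⟨abs_pos.1 h3, ?_⟩
  have h4 := ENNReal.toReal_mono h1 h2
  rwa [← ENNReal.ofReal_inv_of_pos h3, ENNReal.toReal_ofReal (inv_nonneg.2 h3.le)] at h4

lemma GrowthCondition.ne_zero (hg : GrowthCondition α) (hα : α 0 = 0) {n : ℕ} (hn : n ≠ 0) :
    α n ≠ 0 := by
  obtain ⟨k, rfl⟩ := Nat.exists_eq_succ_of_ne_zero hn
  have := (hg.gap (Nat.zero_le k)).1
  rwa [hα, sub_zero] at this

/-- The index `i = 0` in the growth condition gives summability of `|α (n + 1)|⁻¹`, and `t ≤ 1 + t ^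
2`. -/
lemma GrowthCondition.summable_inv_one_add_sq (hg : GrowthCondition α) (hα : α 0 = 0) :
    Summable fun n => (1 + α n ^ 2)⁻¹ := by
  rw [← summable_nat_add_iff 1]
  refine Summable.of_nonneg_of_le (fun n => by positivity) (fun n => ?_) hg.summable_gapSup
  obtain ⟨h1, h2⟩ := hg.gap (Nat.zero_le n)
  rw [hα, sub_zero] at h1 h2
  refine le_trans ?_ h2
  have h3 : 0 < |α (n + 1)| := abs_pos.2 h1
  refine inv_anti₀ h3 ?_
  rw [← sq_abs]
  nlinarith [sq_nonneg (|α (n + 1)| - 1)]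

variable {a : C(CantorGroup, ℂ)} {T : CantorL2 →L[ℂ] CantorL2}

/-- The central estimate. Dividing the kernel's coefficients by the gaps costs at most `gapSup α n`
in norm, and afterwards `T` reproduces the level `n + 1` components of `a` times the kernel. -/
lemma norm_levelExp_succ_sub_le (hα : α 0 = 0) (hg : GrowthCondition α)
    (h : IsCommutatorExtension (cantorDirac α) (mulRep a) T) (n : ℕ) :
    ‖levelExp (n + 1) a - levelExp n a‖ ≤ ‖T‖ * gapSup α n := by
  refine (ContinuousMap.norm_le _ (mul_nonneg (norm_nonneg _) (gapSup_nonneg _ _))).2 fun x => ?_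
  -- This is `(α (n + 1) - D)⁻¹` applied to the kernel at `x`.
  set g := walshSum n fun R => walsh R x * ((α (n + 1) : ℂ) - α (level R))⁻¹ with hgdef
  have hgn : ‖g‖ ≤ gapSup α n * ‖walshKernel n x‖ := by
    refine norm_le_of_coef_le (gapSup_nonneg _ _) fun R => ?_
    rw [hgdef, walshKernel, coef_walshSum, coef_walshSum]
    split_ifs with hR
    · rw [norm_mul, mul_comm, norm_inv, ← Complex.ofReal_sub, Complex.norm_real]
      exact mul_le_mul_of_nonneg_right
        (hg.gap (level_le_iff.2 (Finset.mem_powerset.1 hR))).2 (norm_nonneg _)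
    · simp
  -- Every row index here has level `n + 1`, so the matrix factor of `T` cancels the inverse gap in
  -- `g`.
  have hcoef : ∀ S ∈ (Finset.range n).powerset,
      coef ({n} ∆ S) (mulRep a (walshKernel n x)) = coef ({n} ∆ S) (T g) := by
    intro S hS
    rw [walshKernel, coef_mulRep_walshSum, hgdef, walshSum, map_sum, map_sum]
    refine Finset.sum_congr rfl fun R hR => ?_
    have hS' := level_le_iff.2 (Finset.mem_powerset.1 hS)
    have hR' := level_le_iff.2 (Finset.mem_powerset.1 hR)
    have hl : level ({n} ∆ S) = n + 1 := by
      have h0 : level {n} = n + 1 := by simp [level]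
      rw [symmDiff_comm, level_symmDiff_of_lt (by omega), h0]
    have hne : (α (n + 1) : ℂ) - α (level R) ≠ 0 := by
      exact_mod_cast (hg.gap hR').1
    rw [map_smul, map_smul, h.coef_apply_walshVec hα, hl, smul_eq_mul]
    field_simp
  have hinner : inner ℂ (mulRep (walsh {n}) (walshKernel n x)) (mulRep a (walshKernel n x))
      = inner ℂ (mulRep (walsh {n}) (walshKernel n x)) (T g) := by
    rw [← ContinuousLinearMap.adjoint_inner_right, ← ContinuousLinearMap.adjoint_inner_right,
      ← ContinuousLinearMap.star_eq_adjoint, ← map_star, star_walsh]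
    nth_rw 1 [walshKernel]
    nth_rw 2 [walshKernel]
    rw [inner_walshSum, inner_walshSum]
    refine Finset.sum_congr rfl fun S hS => ?_
    rw [coef_mulRep_walsh, coef_mulRep_walsh, hcoef S hS]
  rw [inner_mulRep_walshKernel] at hinner
  have h1 : ‖(2 ^ n * (walsh {n} x * (levelExp (n + 1) a x - levelExp n a x)) : ℂ)‖
      ≤ 2 ^ n * (‖T‖ * gapSup α n) := by
    rw [hinner, ← norm_walshKernel_sq n x]
    calc _ ≤ ‖mulRep (walsh {n}) (walshKernel n x)‖ * ‖T g‖ := norm_inner_le_norm _ _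
      _ ≤ ‖walshKernel n x‖ * (‖T‖ * (gapSup α n * ‖walshKernel n x‖)) := by
        gcongr
        · exact norm_mulRep_walsh _ _
        · exact (T.le_opNorm g).trans (by gcongr)
      _ = _ := by ring
  rw [norm_mul, norm_mul, norm_pow, Complex.norm_ofNat, norm_walsh_apply, one_mul] at h1
  exact le_of_mul_le_mul_left h1 (by positivity)

lemma norm_sub_levelExp_le (hα : α 0 = 0) (hg : GrowthCondition α)
    (h : IsCommutatorExtension (cantorDirac α) (mulRep a) T) (hT : ‖T‖ ≤ 1) (n : ℕ) :
    ‖levelExp n a - a‖ ≤ ∑' k, gapSup α (n + k) := by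
  rw [← dist_eq_norm]
  refine dist_le_tsum_of_dist_le_of_tendsto (gapSup α) (fun k => ?_) hg.summable_gapSup
    (tendsto_levelExp a) n
  rw [dist_comm, dist_eq_norm]
  exact (norm_levelExp_succ_sub_le hα hg h k).trans
    (mul_le_of_le_one_left (gapSup_nonneg _ _) hT)

/-- The coefficient appears in the `∅`-column of `T`, multiplied by `α (level S) - α 0 = α (level
S)`. -/
lemma norm_walshCoef_le (hα : α 0 = 0) (hg : GrowthCondition α)
    (h : IsCommutatorExtension (cantorDirac α) (mulRep a) T) (hT : ‖T‖ ≤ 1) {S : Finset ℕ}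
    (hS : S ≠ ∅) : ‖walshCoef S a‖ ≤ |α (level S)|⁻¹ := by
  have h1 := h.coef_apply_walshVec hα S ∅
  have hS' : (∅ : Finset ℕ) ∆ S = S := bot_symmDiff S
  have h0 : 0 < |α (level S)| := abs_pos.2 (hg.ne_zero hα (level_eq_zero_iff.not.2 hS))
  rw [hS', level_empty, hα, Complex.ofReal_zero, sub_zero] at h1
  have h2 : ‖coef S (T (walshVec ∅))‖ ≤ 1 := by
    rw [coef_apply]
    refine (norm_inner_le_norm _ _).trans ?_
    rw [orthonormal_walshVec.1 S, one_mul]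
    refine (T.le_opNorm _).trans ?_
    rwa [orthonormal_walshVec.1 ∅, mul_one]
  rw [h1, norm_mul, Complex.norm_real, Real.norm_eq_abs] at h2
  rwa [← one_div, le_div_iff₀' h0]

end Growth

/-! ### The metric on the state space -/

/-- The last two hypotheses are the two inclusions between the given neighbourhood filter and that
of the metric. -/
lemma isMetricForTopology_of_tendsto {X : Type*} [t : TopologicalSpace X] {d : X → X → ℝ≥0∞}
    (hfin : ∀ x y, d x y ≠ ∞) (hself : ∀ x, d x x = 0) (hcomm : ∀ x y, d x y = d y x)
    (htri : ∀ x y z, d x z ≤ d x y + d y z) (hsep : ∀ x y, d x y = 0 → x = y)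
    (hcont : ∀ x, Tendsto (d x) (𝓝 x) (𝓝 0)) (hlim : ∀ x, comap (d x) (𝓝 0) ≤ 𝓝 x) :
    IsMetricForTopology d := by
  let m : MetricSpace X :=
    { dist := fun x y => (d x y).toReal
      dist_self := fun x => by rw [hself, ENNReal.toReal_zero]
      dist_comm := fun x y => by rw [hcomm]
      dist_triangle := fun x y z => by
        rw [← ENNReal.toReal_add (hfin x y) (hfin y z)]
        exact ENNReal.toReal_mono (ENNReal.add_ne_top.2 ⟨hfin x y, hfin y z⟩) (htri x y z)
      eq_of_dist_eq_zero := fun {x y} h =>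
        hsep x y (((ENNReal.toReal_eq_zero_iff _).1 h).resolve_right (hfin x y)) }
  refine ⟨m, fun x y => (ENNReal.ofReal_toReal (hfin x y)).symm, ?_⟩
  refine TopologicalSpace.ext_nhds fun x => ?_
  have h1 : @nhds X m.toPseudoMetricSpace.toUniformSpace.toTopologicalSpace x
      = comap (d x) (𝓝 0) := by
    have h2 : @nhds X m.toPseudoMetricSpace.toUniformSpace.toTopologicalSpace x
        = comap (fun y => (d y x).toReal) (𝓝 0) :=
      (@nhds_comap_dist X m.toPseudoMetricSpace x).symm
    rw [h2]
    apply le_antisymm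
    · rw [← tendsto_iff_comap]
      have h3 : d x = fun y => ENNReal.ofReal (d y x).toReal := by
        ext1 y
        rw [ENNReal.ofReal_toReal (hfin _ _), hcomm]
      rw [h3, ← ENNReal.ofReal_zero]
      exact (ENNReal.continuous_ofReal.tendsto 0).comp tendsto_comap
    · rw [← tendsto_iff_comap]
      have h3 : (fun y => (d y x).toReal) = ENNReal.toReal ∘ d x := by
        ext1 y
        rw [hcomm]; rfl
      rw [h3, ← ENNReal.toReal_zero]
      exact (ENNReal.tendsto_toReal ENNReal.zero_ne_top).comp tendsto_comap
  rw [h1]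
  exact le_antisymm (hlim x) (tendsto_iff_comap.1 (hcont x))

lemma IsMetricForTopology.comap {X Y : Type*} [TopologicalSpace X] [TopologicalSpace Y]
    {d : Y → Y → ℝ≥0∞} (h : IsMetricForTopology d) {f : X → Y} (hf : IsEmbedding f) :
    IsMetricForTopology fun x y => d (f x) (f y) := by
  obtain ⟨m, h1, h2⟩ := h
  refine ⟨MetricSpace.induced f hf.injective m, fun x y => h1 _ _, ?_⟩
  change TopologicalSpace.induced f m.toPseudoMetricSpace.toUniformSpace.toTopologicalSpace = _
  rw [h2]
  exact hf.eq_induced.symm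

section StateEDist

variable {A : Type*} [CStarAlgebra A]
variable {H : Type*} [NormedAddCommGroup H] [InnerProductSpace ℂ H] [CompleteSpace H]
variable (π : A →⋆ₐ[ℂ] (H →L[ℂ] H)) (D : H →ₗ.[ℂ] H)

lemma stateEDist_self (φ : StateSpace A) : stateEDist π D φ φ = 0 := by
  simp [stateEDist]

lemma stateEDist_comm (φ ψ : StateSpace A) : stateEDist π D φ ψ = stateEDist π D ψ φ := by
  unfold stateEDist
  refine iSup_congr fun a => iSup_congr fun _ => ?_
  rw [← enorm_neg, neg_sub]

lemma stateEDist_triangle (φ ψ χ : StateSpace A) :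
    stateEDist π D φ χ ≤ stateEDist π D φ ψ + stateEDist π D ψ χ := by
  refine iSup₂_le fun a ha => ?_
  have h1 : ‖φ.1 a - ψ.1 a‖ₑ ≤ stateEDist π D φ ψ :=
    le_iSup₂ (f := fun (a : A) (_ : a ∈ {a : A | ∃ T : H →L[ℂ] H,
      IsCommutatorExtension D (π a) T ∧ ‖T‖ ≤ 1}) => ‖φ.1 a - ψ.1 a‖ₑ) a ha
  have h2 : ‖ψ.1 a - χ.1 a‖ₑ ≤ stateEDist π D ψ χ :=
    le_iSup₂ (f := fun (a : A) (_ : a ∈ {a : A | ∃ T : H →L[ℂ] H,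
      IsCommutatorExtension D (π a) T ∧ ‖T‖ ≤ 1}) => ‖ψ.1 a - χ.1 a‖ₑ) a ha
  rw [← sub_add_sub_cancel]
  exact (enorm_add_le _ _).trans (add_le_add h1 h2)

variable {π D}

lemma enorm_sub_le_stateEDist {a : A} {T : H →L[ℂ] H} (h : IsCommutatorExtension D (π a) T)
    (hT : ‖T‖ ≤ 1) (φ ψ : StateSpace A) : ‖φ.1 a - ψ.1 a‖ₑ ≤ stateEDist π D φ ψ :=
  le_iSup₂ (f := fun (a : A) (_ : a ∈ {a : A | ∃ T : H →L[ℂ] H,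
    IsCommutatorExtension D (π a) T ∧ ‖T‖ ≤ 1}) => ‖φ.1 a - ψ.1 a‖ₑ) a ⟨T, h, hT⟩

lemma stateEDist_le {φ ψ : StateSpace A} {C : ℝ}
    (h : ∀ (a : A) (T : H →L[ℂ] H), IsCommutatorExtension D (π a) T → ‖T‖ ≤ 1 →
      ‖φ.1 a - ψ.1 a‖ ≤ C) : stateEDist π D φ ψ ≤ ENNReal.ofReal C := by
  refine iSup₂_le fun a ha => ?_
  obtain ⟨T, hT, hT1⟩ := ha
  rw [← ofReal_norm]
  exact ENNReal.ofReal_le_ofReal (h a T hT hT1)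

end StateEDist

/-! ### Norm bounds for states from positivity -/

section States

open scoped ComplexOrder

lemma state_nonneg {X : Type*} [TopologicalSpace X] [CompactSpace X]
    (φ : StateSpace C(X, ℂ)) (f : C(X, ℝ)) (hf : ∀ x, 0 ≤ f x) :
    0 ≤ φ.1 ⟨fun x => (f x : ℂ), by fun_prop⟩ := by
  have h := φ.2.2 ⟨fun x => ((Real.sqrt (f x) : ℝ) : ℂ), by fun_prop⟩
  convert h using 2
  ext x
  change (f x : ℂ) = (starRingEnd ℂ) ((Real.sqrt (f x) : ℝ) : ℂ) * ((Real.sqrt (f x) : ℝ) : ℂ)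
  rw [Complex.conj_ofReal, ← Complex.ofReal_mul, Real.mul_self_sqrt (hf x)]

/-- Positivity applied to `c - f` and `c + f` shows that the value is real and lies between `-c` and
`c`. -/
lemma norm_state_ofReal_le {X : Type*} [TopologicalSpace X] [CompactSpace X]
    (φ : StateSpace C(X, ℂ)) (f : C(X, ℝ)) {c : ℝ} (hf : ∀ x, |f x| ≤ c) :
    ‖φ.1 ⟨fun x => (f x : ℂ), by fun_prop⟩‖ ≤ c := by
  set F : C(X, ℂ) := ⟨fun x => (f x : ℂ), by fun_prop⟩ with hF
  have h1 := state_nonneg φ (ContinuousMap.const X c - f) fun x => by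
    simpa using (abs_le.1 (hf x)).2
  have h2 := state_nonneg φ (ContinuousMap.const X c + f) fun x => by
    have := (abs_le.1 (hf x)).1
    simp only [ContinuousMap.add_apply, ContinuousMap.const_apply]
    linarith
  have e1 : (⟨fun x => ((ContinuousMap.const X c - f) x : ℂ), by fun_prop⟩ : C(X, ℂ))
      = (c : ℂ) • 1 - F := by
    ext x; simp [hF]
  have e2 : (⟨fun x => ((ContinuousMap.const X c + f) x : ℂ), by fun_prop⟩ : C(X, ℂ))
      = (c : ℂ) • 1 + F := by
    ext x; simp [hF]
  rw [e1, map_sub, map_smul, φ.2.1, Complex.le_def] at h1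
  rw [e2, map_add, map_smul, φ.2.1, Complex.le_def] at h2
  simp at h1 h2
  have him : (φ.1 F).im = 0 := h2.2.symm
  have hre : φ.1 F = ((φ.1 F).re : ℂ) := Complex.ext rfl (by simpa using him)
  rw [hre, Complex.norm_real, Real.norm_eq_abs, abs_le]
  constructor <;> linarith [h1.1, h2.1]

/-- Splitting into real and imaginary parts costs the factor `2`, which is harmless for the
topological arguments. -/
lemma norm_state_le {X : Type*} [TopologicalSpace X] [CompactSpace X]
    (φ : StateSpace C(X, ℂ)) (f : C(X, ℂ)) : ‖φ.1 f‖ ≤ 2 * ‖f‖ := by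
  have h1 := norm_state_ofReal_le φ ⟨fun x => (f x).re, by fun_prop⟩ (c := ‖f‖) fun x =>
    (Complex.abs_re_le_norm _).trans (f.norm_coe_le_norm x)
  have h2 := norm_state_ofReal_le φ ⟨fun x => (f x).im, by fun_prop⟩ (c := ‖f‖) fun x =>
    (Complex.abs_im_le_norm _).trans (f.norm_coe_le_norm x)
  have h3 : f = ⟨fun x => ((f x).re : ℂ), by fun_prop⟩
      + Complex.I • (⟨fun x => ((f x).im : ℂ), by fun_prop⟩ : C(X, ℂ)) := by
    ext x
    simp [mul_comm Complex.I]
  rw [h3, map_add, map_smul, ← h3]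
  refine (norm_add_le _ _).trans ?_
  rw [norm_smul, Complex.norm_I, one_mul, two_mul]
  exact add_le_add h1 h2

end States

/-! ### The Dirac distance and the weak*-topology -/

section CantorStates

variable {α : ℕ → ℝ}

/-- The Dirac distance is controlled by the values of the states at finitely many Walsh functions
up to an error which is uniform on the state space. -/
lemma stateEDist_le_sum (hα : α 0 = 0) (hg : GrowthCondition α)
    (φ ψ : StateSpace C(CantorGroup, ℂ)) (n : ℕ) :
    stateEDist mulRep (cantorDirac α) φ ψ ≤ ENNReal.ofReal
      (∑ S ∈ (Finset.range n).powerset, |α (level S)|⁻¹ * ‖φ.1 (walsh S) - ψ.1 (walsh S)‖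
        + 4 * ∑' k, gapSup α (n + k)) := by
  refine stateEDist_le fun a T hT hT1 => ?_
  have h1 := norm_sub_levelExp_le hα hg hT hT1 n
  have h2 : φ.1 a - ψ.1 a = (φ.1 (levelExp n a) - ψ.1 (levelExp n a))
      - (φ.1 (levelExp n a - a) - ψ.1 (levelExp n a - a)) := by
    rw [map_sub, map_sub]; ring
  have h3 : ‖φ.1 (levelExp n a - a) - ψ.1 (levelExp n a - a)‖ ≤ 4 * ∑' k, gapSup α (n + k) :=
    (norm_sub_le _ _).trans (by
      linarith [norm_state_le φ (levelExp n a - a), norm_state_le ψ (levelExp n a - a)])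
  have h4 : ‖φ.1 (levelExp n a) - ψ.1 (levelExp n a)‖
      ≤ ∑ S ∈ (Finset.range n).powerset, |α (level S)|⁻¹ * ‖φ.1 (walsh S) - ψ.1 (walsh S)‖ := by
    rw [levelExp, map_sum, map_sum, ← Finset.sum_sub_distrib]
    refine (norm_sum_le _ _).trans (Finset.sum_le_sum fun S _ => ?_)
    rw [map_smul, map_smul, ← smul_sub, norm_smul]
    -- The constant term has no coefficient bound, but states agree on constants.
    by_cases hS : S = ∅
    · subst hS
      rw [walsh_empty, φ.2.1, ψ.2.1]
      simp
    · exact mul_le_mul_of_nonneg_right (norm_walshCoef_le hα hg hT hT1 hS) (norm_nonneg _)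
  rw [h2]
  exact (norm_sub_le _ _).trans (add_le_add h4 h3)

lemma stateEDist_ne_top (hα : α 0 = 0) (hg : GrowthCondition α)
    (φ ψ : StateSpace C(CantorGroup, ℂ)) : stateEDist mulRep (cantorDirac α) φ ψ ≠ ∞ :=
  ne_top_of_le_ne_top ENNReal.ofReal_ne_top (stateEDist_le_sum hα hg φ ψ 0)

/-- First `n` is chosen so that the tail, which is uniform in the state, is small; the remaining
finite sum is weak*-continuous and vanishes at `φ`. -/
lemma tendsto_stateEDist (hα : α 0 = 0) (hg : GrowthCondition α)
    (φ : StateSpace C(CantorGroup, ℂ)) :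
    Tendsto (stateEDist mulRep (cantorDirac α) φ) (𝓝 φ) (𝓝 0) := by
  have htail : Tendsto (fun n => 4 * ∑' k, gapSup α (n + k)) atTop (𝓝 0) := by
    have := (tendsto_sum_nat_add (gapSup α)).const_mul 4
    simpa [add_comm] using this
  rw [ENNReal.tendsto_nhds_zero]
  intro ε hε
  obtain ⟨δ, hδ0, hδ⟩ : ∃ δ : ℝ, 0 < δ ∧ ENNReal.ofReal δ ≤ ε := by
    rcases eq_or_ne ε ∞ with rfl | h
    · exact ⟨1, one_pos, le_top⟩
    · exact ⟨ε.toReal, ENNReal.toReal_pos hε.ne' h, ENNReal.ofReal_toReal_le⟩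
  obtain ⟨n, hn⟩ := (htail.eventually (gt_mem_nhds (half_pos hδ0))).exists
  have hcont : Tendsto (fun ψ : StateSpace C(CantorGroup, ℂ) =>
      ∑ S ∈ (Finset.range n).powerset, |α (level S)|⁻¹ * ‖φ.1 (walsh S) - ψ.1 (walsh S)‖)
      (𝓝 φ) (𝓝 0) := by
    have hc : Continuous (fun ψ : StateSpace C(CantorGroup, ℂ) =>
        ∑ S ∈ (Finset.range n).powerset, |α (level S)|⁻¹ * ‖φ.1 (walsh S) - ψ.1 (walsh S)‖) := by
      refine continuous_finsetSum _ fun S _ => continuous_const.mul (Continuous.norm ?_)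
      exact continuous_const.sub ((WeakDual.eval_continuous _).comp continuous_subtype_val)
    have := hc.tendsto φ
    simpa using this
  filter_upwards [hcont.eventually (gt_mem_nhds (half_pos hδ0))] with ψ hψ
  refine (stateEDist_le_sum hα hg φ ψ n).trans (le_trans (ENNReal.ofReal_le_ofReal ?_) hδ)
  linarith

/-- Convergence in the Dirac distance implies weak* convergence. -/
lemma tendsto_apply_of_stateEDist (hα : α 0 = 0) (φ : StateSpace C(CantorGroup, ℂ))
    (a : C(CantorGroup, ℂ)) :
    Tendsto (fun ψ : StateSpace C(CantorGroup, ℂ) => ψ.1 a)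
      (comap (stateEDist mulRep (cantorDirac α) φ) (𝓝 0)) (𝓝 (φ.1 a)) := by
  have hspan : ∀ b ∈ Submodule.span ℂ (Set.range walsh),
      Tendsto (fun ψ : StateSpace C(CantorGroup, ℂ) => ψ.1 b)
        (comap (stateEDist mulRep (cantorDirac α) φ) (𝓝 0)) (𝓝 (φ.1 b)) := by
    intro b hb
    obtain ⟨T, hT⟩ := exists_isDomainCommutator hα hb
    -- Adding `1` keeps the normalising constant positive even when `T = 0`.
    set c : ℝ := ‖T‖ + 1 with hc
    have hc0 : 0 < c := by positivity
    have hT' := (hT.smul (c⁻¹ : ℝ)).isCommutatorExtension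
    have hn : ‖((c⁻¹ : ℝ) : ℂ) • T‖ ≤ 1 := by
      rw [norm_smul, Complex.norm_real, Real.norm_eq_abs, abs_of_pos (inv_pos.2 hc0),
        ← div_eq_inv_mul, div_le_one hc0]
      linarith
    rw [tendsto_iff_edist_tendsto_0]
    have hle : ∀ ψ : StateSpace C(CantorGroup, ℂ), edist (ψ.1 b) (φ.1 b)
        ≤ ENNReal.ofReal c * stateEDist mulRep (cantorDirac α) φ ψ := by
      intro ψ
      have h1 := enorm_sub_le_stateEDist hT' hn φ ψ
      have h2 : φ.1 b - ψ.1 b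
          = (c : ℂ) • (φ.1 (((c⁻¹ : ℝ) : ℂ) • b) - ψ.1 (((c⁻¹ : ℝ) : ℂ) • b)) := by
        rw [map_smul, map_smul, ← smul_sub, smul_smul, ← Complex.ofReal_mul,
          mul_inv_cancel₀ hc0.ne', Complex.ofReal_one, one_smul]
      rw [edist_comm, edist_eq_enorm_sub, h2, enorm_smul]
      refine mul_le_mul' (le_of_eq ?_) h1
      rw [← ofReal_norm, Complex.norm_real, Real.norm_eq_abs, abs_of_pos hc0]
    refine tendsto_of_tendsto_of_tendsto_of_le_of_le tendsto_const_nhds ?_ (fun _ => zero_le) hle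
    have h3 : Tendsto (stateEDist mulRep (cantorDirac α) φ)
      (comap (stateEDist mulRep (cantorDirac α) φ) (𝓝 0)) (𝓝 0) := tendsto_comap
    have h4 := ENNReal.Tendsto.const_mul h3 (Or.inr (ENNReal.ofReal_ne_top (r := c)))
    rwa [mul_zero] at h4
  rw [Metric.tendsto_nhds]
  intro ε hε
  -- Two states, each of norm at most `2`, turn the error `ε / 8` into at most `ε / 2`.
  obtain ⟨b, hab, hb⟩ := Metric.dense_iff.1 dense_span_walsh a (ε / 8) (by positivity)
  rw [Metric.mem_ball, dist_comm, dist_eq_norm] at hab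
  filter_upwards [Metric.tendsto_nhds.1 (hspan b hb) (ε / 2) (by positivity)] with ψ hψ
  rw [dist_eq_norm] at hψ ⊢
  have h1 : ψ.1 a - φ.1 a = (ψ.1 b - φ.1 b) + (ψ.1 (a - b) - φ.1 (a - b)) := by
    rw [map_sub, map_sub]; ring
  rw [h1]
  have h2 := norm_add_le (ψ.1 b - φ.1 b) (ψ.1 (a - b) - φ.1 (a - b))
  have h3 := norm_sub_le (ψ.1 (a - b)) (φ.1 (a - b))
  linarith [norm_state_le ψ (a - b), norm_state_le φ (a - b)]

lemma comap_stateEDist_le_nhds (hα : α 0 = 0) (φ : StateSpace C(CantorGroup, ℂ)) :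
    comap (stateEDist mulRep (cantorDirac α) φ) (𝓝 0) ≤ 𝓝 φ := by
  have h : Tendsto (fun ψ : StateSpace C(CantorGroup, ℂ) => ψ)
      (comap (stateEDist mulRep (cantorDirac α) φ) (𝓝 0)) (𝓝 φ) := by
    rw [tendsto_subtype_rng]
    exact (tendsto_iff_forall_eval_tendsto_topDualPairing).2 (tendsto_apply_of_stateEDist hα φ)
  exact h

theorem isMetricForTopology_stateEDist (hα : α 0 = 0) (hg : GrowthCondition α) :
    IsMetricForTopology (stateEDist mulRep (cantorDirac α)) := by
  refine isMetricForTopology_of_tendsto (stateEDist_ne_top hα hg) (stateEDist_self _ _)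
    (stateEDist_comm _ _) (stateEDist_triangle _ _) (fun φ ψ h => ?_) (tendsto_stateEDist hα hg)
    (comap_stateEDist_le_nhds hα)
  -- At distance zero the constant filter at `ψ` converges to `φ` in `d`, so uniqueness of weak*
  -- limits gives `φ = ψ`.
  have h1 : pure ψ ≤ comap (stateEDist mulRep (cantorDirac α) φ) (𝓝 0) := by
    rw [← tendsto_iff_comap, tendsto_pure_left]
    intro s hs
    rw [h]
    exact mem_of_mem_nhds hs
  refine Subtype.ext (DFunLike.ext _ _ fun a => ?_)
  have h2 := (tendsto_apply_of_stateEDist hα φ a).mono_left h1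
  exact tendsto_nhds_unique h2 (tendsto_pure_nhds _ _)

/-- A continuous injection from a compact space into a Hausdorff space; the coordinate functions
give injectivity. -/
lemma isEmbedding_evalState : IsEmbedding evalState := by
  have hc : Continuous evalState := by
    refine continuous_induced_rng.2 (WeakDual.continuous_of_continuous_eval fun a => ?_)
    exact a.continuous
  refine (hc.isClosedEmbedding fun x y h => ?_).isEmbedding
  funext i
  have h1 : (evalState x).1 (coordFun i) = (evalState y).1 (coordFun i) := by rw [h]
  have h2 : ((x i).val : ℂ) = ((y i).val : ℂ) := h1
  exact ZMod.val_injective 2 (by exact_mod_cast h2)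

theorem isMetricForTopology_cantorEDist (hα : α 0 = 0) (hg : GrowthCondition α) :
    IsMetricForTopology (cantorEDist α) :=
  (isMetricForTopology_stateEDist hα hg).comap isEmbedding_evalState

theorem isUnboundedFredholmModule_cantorDirac (hα : α 0 = 0) (hg : GrowthCondition α) :
    IsUnboundedFredholmModule mulRep (cantorDirac α) where
  selfAdjoint := isSelfAdjoint_cantorDirac hα
  dense_lipschitz := dense_span_walsh.mono fun a ha => by
    obtain ⟨T, hT⟩ := exists_isDomainCommutator hα ha
    exact ⟨T, hT.isCommutatorExtension⟩
  compact_resolvent := ⟨_, isInverseOneAddSq_levelDiagonal hα (hg.summable_inv_one_add_sq hα),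
    isCompactOperator_levelDiagonal (hg.summable_inv_one_add_sq hα)⟩

end CantorStates

/-! ### The geometric eigenvalues -/

section Points

variable {α : ℕ → ℝ}

lemma levelExp_eq_of_eq (n : ℕ) (a : C(CantorGroup, ℂ)) {x y : CantorGroup}
    (h : ∀ i < n, x i = y i) : levelExp n a x = levelExp n a y := by
  rw [levelExp_apply, levelExp_apply]
  refine Finset.sum_congr rfl fun S hS => ?_
  rw [walsh_apply, walsh_apply]
  congr 1
  refine Finset.prod_congr rfl fun i hi => ?_
  rw [h i (Finset.mem_range.1 (Finset.mem_powerset.1 hS hi))]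

/-- The function `levelExp n a` depends only on the first `n` coordinates, so it takes the same
value at `x` and `y`; only `levelExp n a - a` contributes, once at each point. -/
lemma cantorEDist_le_of_eq (hα : α 0 = 0) (hg : GrowthCondition α) {n : ℕ} {x y : CantorGroup}
    (h : ∀ i < n, x i = y i) :
    cantorEDist α x y ≤ ENNReal.ofReal (2 * ∑' k, gapSup α (n + k)) := by
  refine stateEDist_le fun a T hT hT1 => ?_
  have h1 := norm_sub_levelExp_le hα hg hT hT1 n
  have h2 : a x - a y = (levelExp n a - a) y - (levelExp n a - a) x := by
    rw [ContinuousMap.sub_apply, ContinuousMap.sub_apply, levelExp_eq_of_eq n a h]; ring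
  change ‖a x - a y‖ ≤ _
  rw [h2]
  refine (norm_sub_le _ _).trans ?_
  linarith [(levelExp n a - a).norm_coe_le_norm x, (levelExp n a - a).norm_coe_le_norm y]

lemma norm_walsh_singleton_sub {n : ℕ} {x y : CantorGroup} (h : x n ≠ y n) :
    ‖walsh {n} x - walsh {n} y‖ = 2 := by
  rw [walsh_apply, walsh_apply, Finset.prod_singleton, Finset.prod_singleton]
  have hv : ∀ z : ZMod 2, z.val = 0 ∨ z.val = 1 := fun z => by have := z.val_lt; omega
  have hne : (x n).val ≠ (y n).val := fun h' => h (ZMod.val_injective 2 h')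
  rcases hv (x n) with h1 | h1 <;> rcases hv (y n) with h2 | h2
  · exact absurd (h1.trans h2.symm) hne
  · rw [h1, h2]; norm_num
  · rw [h1, h2]; norm_num
  · exact absurd (h1.trans h2.symm) hne

/-- The test function is `c⁻¹ • walsh {n}`, whose values at the two points differ by `2 * c⁻¹`.
Multiplication by `walsh {n}` exchanges level `n + 1` with the levels at most `n` and preserves all
higher levels, so its commutator has norm at most `c`. -/
lemma le_cantorEDist (hα : α 0 = 0) {n : ℕ} {x y : CantorGroup} (h : x n ≠ y n) {c : ℝ}
    (hc : 0 < c) (hle : ∀ i ≤ n, |α (n + 1) - α i| ≤ c) :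
    ENNReal.ofReal (2 * c⁻¹) ≤ cantorEDist α x y := by
  have hlev : level {n} = n + 1 := by simp [level]
  have hN : ‖mulRep (walsh {n}) ∘L walshShift α {n}‖ ≤ c := by
    refine norm_walsh_commutator_le hc.le fun R => ?_
    rcases lt_trichotomy (level R) (n + 1) with hR | hR | hR
    · rw [symmDiff_comm, level_symmDiff_of_lt (hlev.symm ▸ hR), hlev]
      exact hle _ (Nat.lt_succ_iff.1 hR)
    -- A set of level exactly `n + 1` contains `n`; removing `n` drops the level to at most `n`.
    · have h1 : level ({n} ∆ R) ≤ n := by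
        rw [level_le_iff]
        have h2 : R ⊆ Finset.range (n + 1) := level_le_iff.1 hR.le
        have h3 : n ∈ R := by
          by_contra h3
          have h4 : level R ≤ n := by
            rw [level_le_iff]
            intro i hi
            have h5 := Finset.mem_range.1 (h2 hi)
            have h6 : i ≠ n := fun h => h3 (h ▸ hi)
            exact Finset.mem_range.2 (by omega)
          omega
        intro i hi
        rcases Finset.mem_symmDiff.1 hi with ⟨h4, h5⟩ | ⟨h4, h5⟩
        · rw [Finset.mem_singleton.1 h4] at h5
          exact absurd h3 h5
        · have h6 := Finset.mem_range.1 (h2 h4)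
          have h7 : i ≠ n := fun h => h5 (Finset.mem_singleton.2 h)
          exact Finset.mem_range.2 (by omega)
      rw [abs_sub_comm, hR]
      exact hle _ h1
    · rw [level_symmDiff_of_lt (hlev.symm ▸ hR), sub_self, abs_zero]
      exact hc.le
  have h1 := ((isDomainCommutator_walsh hα {n}).smul ((c⁻¹ : ℝ) : ℂ)).isCommutatorExtension
  have h2 : ‖((c⁻¹ : ℝ) : ℂ) • (mulRep (walsh {n}) ∘L walshShift α {n})‖ ≤ 1 := by
    rw [norm_smul, Complex.norm_real, Real.norm_eq_abs, abs_of_pos (inv_pos.2 hc),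
      ← div_eq_inv_mul, div_le_one hc]
    exact hN
  have h3 := enorm_sub_le_stateEDist h1 h2 (evalState x) (evalState y)
  refine le_trans (le_of_eq ?_) h3
  change _ = ‖((c⁻¹ : ℝ) : ℂ) * walsh {n} x - ((c⁻¹ : ℝ) : ℂ) * walsh {n} y‖ₑ
  rw [← mul_sub, ← ofReal_norm, norm_mul, norm_walsh_singleton_sub h, Complex.norm_real,
    Real.norm_eq_abs, abs_of_pos (inv_pos.2 hc), mul_comm]

end Points

lemma firstDiffCoord_spec {x y : CantorGroup} (h : x ≠ y) :
    x (firstDiffCoord x y - 1) ≠ y (firstDiffCoord x y - 1) ∧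
      ∀ i < firstDiffCoord x y - 1, x i = y i := by
  have hne : {n : ℕ | 1 ≤ n ∧ x (n - 1) ≠ y (n - 1)}.Nonempty := by
    obtain ⟨i, hi⟩ := Function.ne_iff.1 h
    exact ⟨i + 1, by omega, hi⟩
  refine ⟨(Nat.sInf_mem hne).2, fun i hi => ?_⟩
  by_contra hi'
  have h1 : firstDiffCoord x y ≤ i + 1 := Nat.sInf_le ⟨by omega, hi'⟩
  omega

/-! ### Gaps and distance bounds for `γ ^ (-n + 1)` -/

section Geometric

variable {γ : ℝ}

lemma geometricEigenvalues_zero (γ : ℝ) : geometricEigenvalues γ 0 = 0 := if_pos rfl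

lemma geometricEigenvalues_succ (γ : ℝ) (n : ℕ) :
    geometricEigenvalues γ (n + 1) = (γ ^ n)⁻¹ := by
  rw [geometricEigenvalues, if_neg n.succ_ne_zero]
  have : (-((n + 1 : ℕ) : ℤ) + 1) = -(n : ℤ) := by push_cast; ring
  rw [this, zpow_neg, zpow_natCast]

/-- The worst case is the preceding eigenvalue `γ ^ (-n + 1)`, at distance `(1 - γ) / γ ^ n` when `1
≤ n`. -/
lemma geometricEigenvalues_gap (h0 : 0 < γ) (h1 : γ < 1) {n i : ℕ} (hi : i ≤ n) :
    (1 - γ) / γ ^ n ≤ geometricEigenvalues γ (n + 1) - geometricEigenvalues γ i ∧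
      0 ≤ geometricEigenvalues γ i := by
  rw [geometricEigenvalues_succ]
  have hn : 0 < γ ^ n := pow_pos h0 n
  rcases i with _ | j
  · rw [geometricEigenvalues_zero, sub_zero, ← one_div]
    exact ⟨by gcongr; linarith, le_rfl⟩
  · rw [geometricEigenvalues_succ]
    refine ⟨?_, by positivity⟩
    have h2 : γ ^ n ≤ γ ^ (j + 1) := pow_le_pow_of_le_one h0.le h1.le hi
    have h3 : (γ ^ j)⁻¹ ≤ γ / γ ^ n := by
      rw [inv_eq_one_div, div_le_div_iff₀ (pow_pos h0 j) hn, one_mul, ← pow_succ']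
      exact h2
    rw [sub_div, one_div]
    linarith

lemma inv_geometricEigenvalues_gap_le (h0 : 0 < γ) (h1 : γ < 1) {n i : ℕ} (hi : i ≤ n) :
    (ENNReal.ofReal |geometricEigenvalues γ (n + 1) - geometricEigenvalues γ i|)⁻¹
      ≤ ENNReal.ofReal (γ ^ n / (1 - γ)) := by
  have h2 := (geometricEigenvalues_gap h0 h1 hi).1
  have h3 : 0 < (1 - γ) / γ ^ n := div_pos (by linarith) (pow_pos h0 n)
  rw [abs_of_pos (h3.trans_le h2), ← ENNReal.ofReal_inv_of_pos (h3.trans_le h2), ← inv_div (1 - γ)]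
  exact ENNReal.ofReal_le_ofReal (inv_anti₀ h3 h2)

lemma gapSup_geometricEigenvalues_le (h0 : 0 < γ) (h1 : γ < 1) (n : ℕ) :
    gapSup (geometricEigenvalues γ) n ≤ γ ^ n / (1 - γ) :=
  ENNReal.toReal_le_of_le_ofReal (div_nonneg (pow_nonneg h0.le n) (by linarith))
    (iSup₂_le fun _ hi => inv_geometricEigenvalues_gap_le h0 h1 hi)

lemma growthCondition_geometricEigenvalues (h0 : 0 < γ) (h1 : γ < 1) :
    GrowthCondition (geometricEigenvalues γ) := by
  have hs : Summable fun n : ℕ => γ ^ n / (1 - γ) :=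
    (summable_geometric_of_lt_one h0.le h1).div_const _
  refine lt_of_le_of_lt (ENNReal.tsum_le_tsum fun n =>
    iSup₂_le fun _ hi => inv_geometricEigenvalues_gap_le h0 h1 hi) ?_
  rw [← ENNReal.ofReal_tsum_of_nonneg
    (fun n => div_nonneg (pow_nonneg h0.le n) (by linarith)) hs]
  exact ENNReal.ofReal_lt_top

lemma tsum_gapSup_geometricEigenvalues_le (h0 : 0 < γ) (h1 : γ < 1) (n : ℕ) :
    ∑' k, gapSup (geometricEigenvalues γ) (n + k) ≤ γ ^ n / (1 - γ) ^ 2 := by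
  have hs : HasSum (fun k : ℕ => γ ^ n / (1 - γ) * γ ^ k) (γ ^ n / (1 - γ) * (1 - γ)⁻¹) :=
    (hasSum_geometric_of_lt_one h0.le h1).mul_left _
  have h2 : γ ^ n / (1 - γ) * (1 - γ)⁻¹ = γ ^ n / (1 - γ) ^ 2 := by
    rw [sq, ← div_eq_mul_inv, div_div]
  rw [← h2, ← hs.tsum_eq]
  have hle : ∀ k, gapSup (geometricEigenvalues γ) (n + k) ≤ γ ^ n / (1 - γ) * γ ^ k := fun k =>
    (gapSup_geometricEigenvalues_le h0 h1 (n + k)).trans_eq (by rw [pow_add]; ring)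
  exact (Summable.of_nonneg_of_le (fun k => gapSup_nonneg _ _) hle hs.summable).tsum_le_tsum hle
    hs.summable

theorem cantorEDist_geometricEigenvalues_bounds (h0 : 0 < γ) (h1 : γ < 1) {x y : CantorGroup}
    (h : x ≠ y) :
    ENNReal.ofReal (2 * γ ^ (firstDiffCoord x y - 1)) ≤
        cantorEDist (geometricEigenvalues γ) x y ∧
      cantorEDist (geometricEigenvalues γ) x y ≤
        ENNReal.ofReal (2 * (γ ^ (firstDiffCoord x y - 1) / (1 - γ) ^ 2)) := by
  obtain ⟨h2, h3⟩ := firstDiffCoord_spec h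
  set n := firstDiffCoord x y - 1
  have hn : 0 < γ ^ n := pow_pos h0 n
  constructor
  -- Here `c = (γ ^ n)⁻¹ = α (n + 1)`, since the eigenvalues are nonnegative and the largest
  -- difference is the one with `α 0 = 0`.
  · have := le_cantorEDist (geometricEigenvalues_zero γ) h2 (inv_pos.2 hn) fun i hi => by
      obtain ⟨h4, h5⟩ := geometricEigenvalues_gap h0 h1 hi
      have h6 : 0 < (1 - γ) / γ ^ n := div_pos (by linarith) hn
      rw [abs_of_pos (h6.trans_le h4), geometricEigenvalues_succ]
      linarith
    rwa [inv_inv] at this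
  · refine (cantorEDist_le_of_eq (geometricEigenvalues_zero γ)
      (growthCondition_geometricEigenvalues h0 h1) h3).trans (ENNReal.ofReal_le_ofReal ?_)
    have := tsum_gapSup_geometricEigenvalues_le h0 h1 n
    linarith

end Geometric

/-! ### Summability -/

section Trace

variable {H : Type*} [NormedAddCommGroup H] [InnerProductSpace ℂ H] [CompleteSpace H]

/-- The continuous functional calculus acts on an eigenvector through the eigenvalue. -/
lemma cfc_apply_eigenvector {R : H →L[ℂ] H} (hR : IsSelfAdjoint R) {f : ℝ → ℝ}
    (hf : ContinuousOn f (spectrum ℝ R)) {v : H} (hv : v ≠ 0) {t : ℝ} (h : R v = (t : ℂ) • v) :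
    cfc f R v = (f t : ℂ) • v := by
  have ht : t ∈ spectrum ℝ R := by
    intro hu
    obtain ⟨u, hu⟩ := hu
    have h1 : (u : H →L[ℂ] H) v = 0 := by
      rw [hu, sub_apply, h, Algebra.algebraMap_eq_smul_one]
      change t • v - (t : ℂ) • v = 0
      rw [Complex.coe_smul, sub_self]
    apply hv
    have h2 : ((u⁻¹ : (H →L[ℂ] H)ˣ) : H →L[ℂ] H) ((u : H →L[ℂ] H) v) = v := by
      rw [← mul_apply_eq_comp, Units.inv_mul]; rfl
    rw [← h2, h1, map_zero]
  rw [cfc_apply f R hR hf]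
  -- By Stone–Weierstrass it is enough to check constants, the identity function, sums, products and
  -- limits.
  have key : ∀ g : C(spectrum ℝ R, ℝ), cfcHom hR g v = (g ⟨t, ht⟩ : ℂ) • v := by
    intro g
    induction g using ContinuousMap.induction_on_of_compact with
    | const r =>
      have h1 : cfcHom hR (ContinuousMap.const _ r) = algebraMap ℝ (H →L[ℂ] H) r :=
        AlgHomClass.commutes (cfcHom hR) r
      rw [h1, Algebra.algebraMap_eq_smul_one]
      change r • v = (r : ℂ) • v
      rw [Complex.coe_smul]
    | id =>
      rw [cfcHom_id hR]
      exact h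
    | star_id =>
      rw [star_trivial, cfcHom_id hR]
      exact h
    | add f g hf hg =>
      rw [map_add, add_apply, hf, hg, ContinuousMap.add_apply, Complex.ofReal_add, add_smul]
    | mul f g hf hg =>
      rw [map_mul, mul_apply_eq_comp, hg, map_smul, hf, ContinuousMap.mul_apply,
        Complex.ofReal_mul, smul_smul, mul_comm]
    | frequently g hg =>
      have hc : IsClosed {g : C(spectrum ℝ R, ℝ) | cfcHom hR g v = (g ⟨t, ht⟩ : ℂ) • v} := by
        refine isClosed_eq ?_ ?_
        · exact (ContinuousLinearMap.apply ℂ H v).continuous.comp (cfcHom_continuous hR)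
        · exact (Complex.continuous_ofReal.comp (continuous_eval_const (⟨t, ht⟩ : spectrum ℝ R))).smul
            continuous_const
      exact hc.mem_of_frequently_of_tendsto hg tendsto_id
  exact key _

/-- The real powers of a positive operator, by the continuous functional calculus. -/
def operatorRpow (R : H →L[ℂ] H) (r : ℝ) : H →L[ℂ] H := R ^ r

lemma inner_operatorRpow_of_eigenvector {R : H →L[ℂ] H} (hR : R.IsPositive) {r : ℝ} (hr : 0 ≤ r)
    {v : H} (hv : v ≠ 0) {t : ℝ} (h : R v = (t : ℂ) • v) (w : H) :
    inner ℂ v (operatorRpow R r w) = ((t ^ r : ℝ) : ℂ) * inner ℂ v w := by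
  have hpos : 0 ≤ R := ContinuousLinearMap.nonneg_iff_isPositive R |>.2 hR
  have h1 : (R ^ r) v = ((t ^ r : ℝ) : ℂ) • v := by
    rw [CFC.rpow_eq_cfc_real hpos]
    exact cfc_apply_eigenvector (IsSelfAdjoint.of_nonneg hpos)
      (Real.continuous_rpow_const hr).continuousOn hv h
  have h2 : IsSelfAdjoint (R ^ r) := IsSelfAdjoint.of_nonneg CFC.rpow_nonneg
  rw [operatorRpow, ← ContinuousLinearMap.adjoint_inner_left,
    ← ContinuousLinearMap.star_eq_adjoint, h2.star_eq, h1, inner_smul_left, Complex.conj_ofReal]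

end Trace

lemma isPositive_levelDiagonal {c : ℕ → ℝ} (hc : Summable c) (h0 : ∀ n, 0 ≤ c n) :
    (levelDiagonal c).IsPositive := by
  rw [ContinuousLinearMap.isPositive_iff_complex]
  intro ξ
  have h1 : HasSum (fun S => ((c (level S) * ‖coef S ξ‖ ^ 2 : ℝ) : ℂ))
      (inner ℂ (levelDiagonal c ξ) ξ) := by
    convert inner_eq_tsum_coef (levelDiagonal c ξ) ξ using 2 with S
    rw [coef_levelDiagonal hc, map_mul, Complex.conj_ofReal, mul_assoc, ← Complex.normSq_eq_conj_mul_self,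
      Complex.normSq_eq_norm_sq]
    push_cast
    rfl
  have h2 : HasSum (fun S => c (level S) * ‖coef S ξ‖ ^ 2) (inner ℂ (levelDiagonal c ξ) ξ).re :=
    Complex.hasSum_re h1
  have h3 := h1.unique (Complex.hasSum_ofReal.2 h2)
  exact ⟨h3.symm, h2.nonneg fun S => mul_nonneg (h0 _) (sq_nonneg _)⟩

lemma levelDiagonal_walshVec {c : ℕ → ℝ} (hc : Summable c) (S : Finset ℕ) :
    levelDiagonal c (walshVec S) = (c (level S) : ℂ) • walshVec S := by
  refine ext_coef fun R => ?_
  rw [coef_levelDiagonal hc, map_smul, coef_walshVec, smul_eq_mul]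
  by_cases h : R = S
  · subst h; rfl
  · simp [h]

lemma coef_levelDiagonal_rpow {c : ℕ → ℝ} (hc : Summable c) (h0 : ∀ n, 0 ≤ c n) {r : ℝ}
    (hr : 0 ≤ r) (S : Finset ℕ) (ξ : CantorL2) :
    coef S (operatorRpow (levelDiagonal c) r ξ) = ((c (level S) ^ r : ℝ) : ℂ) * coef S ξ :=
  inner_operatorRpow_of_eigenvector (isPositive_levelDiagonal hc h0) hr
    (orthonormal_walshVec.ne_zero S) (levelDiagonal_walshVec hc S) ξ

/-- For a nonnegative diagonal operator the trace is the sum of the diagonal entries in any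
orthonormal basis, by Tonelli and Parseval. -/
lemma hasFiniteTrace_iff {T : CantorL2 →L[ℂ] CantorL2} {t : Finset ℕ → ℝ} (ht : ∀ S, 0 ≤ t S)
    (hT : ∀ S ξ, coef S (T ξ) = (t S : ℂ) * coef S ξ) : HasFiniteTrace T ↔ Summable t := by
  have hform : ∀ ξ, HasSum (fun S => t S * ‖coef S ξ‖ ^ 2) (inner ℂ ξ (T ξ)).re := by
    intro ξ
    have h1 := Complex.hasSum_re (inner_eq_tsum_coef ξ (T ξ))
    convert h1 using 2 with S
    rw [hT, mul_left_comm, ← Complex.normSq_eq_conj_mul_self, Complex.normSq_eq_norm_sq,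
      ← Complex.ofReal_mul, Complex.ofReal_re]
  have hreal : ∀ ξ, inner ℂ ξ (T ξ) = ((inner ℂ ξ (T ξ) : ℂ).re : ℂ) := by
    intro ξ
    refine (inner_eq_tsum_coef ξ (T ξ)).unique ?_
    convert Complex.hasSum_ofReal.2 (hform ξ) using 2 with S
    rw [hT, mul_left_comm, ← Complex.normSq_eq_conj_mul_self, Complex.normSq_eq_norm_sq,
      ← Complex.ofReal_mul]
  constructor
  · intro h
    -- `HasFiniteTrace` speaks of bases indexed by subsets of the space, so the Walsh basis is
    -- reindexed by its range.
    let e : Finset ℕ ≃ Set.range walshVec :=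
      Equiv.ofInjective walshVec orthonormal_walshVec.linearIndependent.injective
    have ho : Orthonormal ℂ (fun v : Set.range walshVec => (v : CantorL2)) :=
      orthonormal_walshVec.toSubtypeRange
    have h1 := h _ (HilbertBasis.mk ho (by rw [Subtype.range_coe]; exact span_walshVec_dense))
    rw [HilbertBasis.coe_mk, ← e.summable_iff] at h1
    rw [← Complex.summable_ofReal]
    convert h1 using 2 with S
    change (t S : ℂ) = inner ℂ (walshVec S) (T (walshVec S))
    rw [← coef_apply, hT, coef_walshVec, if_pos rfl, mul_one]
  · intro h s b
    have h1 : Summable fun p : Finset ℕ × s => t p.1 * ‖coef p.1 (b p.2)‖ ^ 2 := by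
      have hb : ∀ S, HasSum (fun i : s => ‖coef S (b i)‖ ^ 2) 1 := by
        intro S
        have h2 := Complex.hasSum_re (b.hasSum_inner_mul_inner (walshVec S) (walshVec S))
        rw [inner_walshVec, if_pos rfl, Complex.one_re] at h2
        convert h2 using 2 with i
        rw [← inner_conj_symm (b i), ← coef_apply, Complex.mul_conj, Complex.normSq_eq_norm_sq,
          Complex.ofReal_re]
      rw [summable_prod_of_nonneg fun p => mul_nonneg (ht _) (sq_nonneg _)]
      refine ⟨fun S => ((hb S).mul_left (t S)).summable, ?_⟩
      simp_rw [tsum_mul_left, (hb _).tsum_eq, mul_one]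
      exact h
    -- The double series was summed first over the arbitrary basis, where Parseval gives `1`; the
    -- order is now exchanged.
    have h2 := h1.prod_symm.prod
    have h3 : ∀ i, ∑' S, t S * ‖coef S (b i)‖ ^ 2 = (inner ℂ (b i) (T (b i)) : ℂ).re :=
      fun i => (hform (b i)).tsum_eq
    have h4 : Summable fun i => (inner ℂ (b i) (T (b i)) : ℂ).re := by
      refine h2.congr fun i => ?_
      exact h3 i
    convert Complex.summable_ofReal.2 h4 using 2 with i
    exact hreal (b i)

/-- There are `2 ^ n` Walsh functions of level `n + 1`. -/
lemma summable_level_iff {f : ℕ → ℝ} (hf : ∀ n, 0 ≤ f n) :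
    (Summable fun S => f (level S)) ↔ Summable fun n => 2 ^ n * f (n + 1) := by
  have hfin : ∀ n, {S | level S = n}.Finite := fun n =>
    (Finset.finite_toSet (Finset.range n).powerset).subset fun S hS =>
      Finset.mem_powerset.2 (level_le_iff.1 (le_of_eq hS))
  have hcard : ∀ n, Nat.card {S // level S = n + 1} = 2 ^ n := by
    intro n
    have h1 : Set.ncard {S | level S = n + 1} = 2 ^ n := by
      -- Level `n + 1` means contained in `range (n + 1)` but not in `range n`, so the count is `2 ^
      -- (n + 1) - 2 ^ n`.
      have h2 : {S | level S = n + 1}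
          = ((Finset.range (n + 1)).powerset \ (Finset.range n).powerset : Finset (Finset ℕ)) := by
        ext S
        simp only [Set.mem_ofPred_eq, Finset.coe_sdiff, Set.mem_sdiff, Finset.mem_coe,
          Finset.mem_powerset, ← level_le_iff]
        omega
      rw [h2, Set.ncard_coe_finset, Finset.card_sdiff_of_subset
        (Finset.powerset_mono.2 (Finset.range_subset_range.2 (Nat.le_succ n)))]
      simp [pow_succ]
      omega
    exact h1
  rw [← (Equiv.sigmaFiberEquiv level).summable_iff]
  change (Summable fun q : (n : ℕ) × {S // level S = n} =>
    f (level (Equiv.sigmaFiberEquiv level q))) ↔ _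
  rw [summable_sigma_of_nonneg fun p => hf _]
  have hfib : ∀ n, ∑' S : {S // level S = n}, f (level S) = Nat.card {S // level S = n} * f n := by
    intro n
    have : ∀ S : {S // level S = n}, f (level S) = f n := fun S => by rw [S.2]
    simp_rw [this]
    rw [tsum_const, nsmul_eq_mul]
  have h2 : ∀ n, Summable fun S : {S // level S = n} => f (level S) := fun n => by
    have := (hfin n).to_subtype
    have : Finite {S // level S = n} := this
    exact Summable.of_finite
  constructor
  · rintro ⟨-, h⟩
    have h3 := (summable_nat_add_iff 1).2 h
    refine h3.congr fun n => ?_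
    have := hfib (n + 1)
    rw [hcard] at this
    exact (this.trans (by push_cast; rfl))
  · intro h
    refine ⟨h2, ?_⟩
    rw [← summable_nat_add_iff 1]
    refine h.congr fun n => ?_
    have := hfib (n + 1)
    rw [hcard] at this
    exact (this.trans (by push_cast; rfl)).symm

section Geometric

variable {γ : ℝ}

/-- Up to constants the terms are `(2 * γ ^ p) ^ n`, and `2 * γ ^ p < 1` is the stated inequality
after taking logarithms. -/
lemma summable_geometricEigenvalues_iff (h0 : 0 < γ) (h1 : γ < 1) {p : ℝ} (hp : 0 < p) :
    (Summable fun n => 2 ^ n * ((1 + geometricEigenvalues γ (n + 1) ^ 2)⁻¹) ^ (p / 2)) ↔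
      Real.log 2 / (-Real.log γ) < p := by
  have hlog : 0 < -Real.log γ := neg_pos.2 (Real.log_neg h0 h1)
  have hiff : 2 * γ ^ p < 1 ↔ Real.log 2 / (-Real.log γ) < p := by
    have hγp : 0 < γ ^ p := Real.rpow_pos_of_pos h0 p
    rw [div_lt_iff₀ hlog, ← Real.log_lt_log_iff (by positivity) one_pos, Real.log_one,
      Real.log_mul two_ne_zero hγp.ne', Real.log_rpow h0]
    constructor <;> intro h <;> linarith
  have hpow : ∀ n : ℕ, ((γ ^ n) ^ 2) ^ (p / 2) = (γ ^ p) ^ n := by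
    intro n
    rw [← Real.rpow_natCast (γ ^ n), ← Real.rpow_mul (pow_nonneg h0.le n), ← Real.rpow_natCast γ,
      ← Real.rpow_mul h0.le, ← Real.rpow_natCast (γ ^ p), ← Real.rpow_mul h0.le]
    congr 1
    push_cast
    ring
  have hterm : ∀ n : ℕ, (1 + geometricEigenvalues γ (n + 1) ^ 2)⁻¹
      = (γ ^ n) ^ 2 / (1 + (γ ^ n) ^ 2) := by
    intro n
    have hn : 0 < γ ^ n := pow_pos h0 n
    rw [geometricEigenvalues_succ]
    field_simp
    ring
  have hup : ∀ n : ℕ, ((1 + geometricEigenvalues γ (n + 1) ^ 2)⁻¹) ^ (p / 2) ≤ (γ ^ p) ^ n := by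
    intro n
    rw [hterm, ← hpow]
    refine Real.rpow_le_rpow (by positivity) ?_ (by positivity)
    exact div_le_self (sq_nonneg _) (by linarith [sq_nonneg (γ ^ n)])
  -- The constant comes from `1 + (γ ^ n) ^ 2 ≤ 2`.
  have hlow : ∀ n : ℕ, (1 / 2 : ℝ) ^ (p / 2) * (γ ^ p) ^ n
      ≤ ((1 + geometricEigenvalues γ (n + 1) ^ 2)⁻¹) ^ (p / 2) := by
    intro n
    rw [hterm, ← hpow, ← Real.mul_rpow (by norm_num) (sq_nonneg _)]
    refine Real.rpow_le_rpow (by positivity) ?_ (by positivity)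
    rw [one_div, ← div_eq_inv_mul]
    have hn1 : γ ^ n ≤ 1 := pow_le_one₀ h0.le h1.le
    have hn0 : 0 < γ ^ n := pow_pos h0 n
    gcongr
    nlinarith
  have hgeo : ∀ n : ℕ, (2 : ℝ) ^ n * (γ ^ p) ^ n = (2 * γ ^ p) ^ n := fun n =>
    (mul_pow _ _ _).symm
  have hnn : 0 ≤ 2 * γ ^ p := by positivity
  rw [← hiff]
  constructor
  · intro h
    have h2 : Summable fun n : ℕ => (1 / 2 : ℝ) ^ (p / 2) * (2 * γ ^ p) ^ n := by
      refine Summable.of_nonneg_of_le (fun n => by positivity) (fun n => ?_) h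
      rw [← hgeo, mul_left_comm]
      exact mul_le_mul_of_nonneg_left (hlow n) (by positivity)
    rw [summable_mul_left_iff (by positivity), summable_geometric_iff_norm_lt_one,
      Real.norm_of_nonneg hnn] at h2
    exact h2
  · intro h
    refine Summable.of_nonneg_of_le (fun n => by positivity) (fun n => ?_)
      (summable_geometric_of_lt_one hnn h)
    rw [← hgeo]
    exact mul_le_mul_of_nonneg_left (hup n) (by positivity)

theorem isPSummable_geometricEigenvalues_iff (h0 : 0 < γ) (h1 : γ < 1) {p : ℝ} (hp : 0 < p) :
    IsPSummable (cantorDirac (geometricEigenvalues γ)) p ↔ Real.log 2 / (-Real.log γ) < p := by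
  have hz := geometricEigenvalues_zero γ
  have hc := (growthCondition_geometricEigenvalues h0 h1).summable_inv_one_add_sq hz
  have hinv := isInverseOneAddSq_levelDiagonal hz hc
  have hc0 : ∀ n, 0 ≤ (1 + geometricEigenvalues γ n ^ 2)⁻¹ := fun n => by positivity
  have hr0 : ∀ n, 0 ≤ ((1 + geometricEigenvalues γ n ^ 2)⁻¹) ^ (p / 2) := fun n => by positivity
  have htr := hasFiniteTrace_iff (fun S => hr0 (level S))
    (coef_levelDiagonal_rpow hc hc0 (half_pos hp).le)
  rw [← summable_geometricEigenvalues_iff h0 h1 hp, ← summable_level_iff hr0, ← htr]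
  constructor
  · rintro ⟨-, R, hR, hR'⟩
    -- Uniqueness of the inverse identifies the existential witness with the explicit diagonal
    -- operator.
    rwa [hR.unique hinv] at hR'
  · exact fun h => ⟨hp, _, hinv, h⟩

end Geometric

end

theorem theorem4p1 :
    (∀ α : ℕ → ℝ, α 0 = 0 → GrowthCondition α →
      IsUnboundedFredholmModule mulRep (cantorDirac α) ∧
      IsMetricForTopology (stateEDist mulRep (cantorDirac α)) ∧
      IsMetricForTopology (cantorEDist α)) ∧
    (∀ γ : ℝ, 0 < γ → γ < 1 →
      GrowthCondition (geometricEigenvalues γ) ∧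
      (∀ p : ℝ, 0 < p →
        (IsPSummable (cantorDirac (geometricEigenvalues γ)) p ↔
          Real.log 2 / (-Real.log γ) < p)) ∧
      ∀ x y : CantorGroup, x ≠ y →
        ENNReal.ofReal (2 * γ ^ (firstDiffCoord x y - 1)) ≤
            cantorEDist (geometricEigenvalues γ) x y ∧
          cantorEDist (geometricEigenvalues γ) x y ≤
            ENNReal.ofReal (2 * (γ ^ (firstDiffCoord x y - 1) / (1 - γ) ^ 2))) := by
  refine ⟨fun α hα hg => ⟨isUnboundedFredholmModule_cantorDirac hα hg,
    isMetricForTopology_stateEDist hα hg, isMetricForTopology_cantorEDist hα hg⟩,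
    fun γ h0 h1 => ⟨growthCondition_geometricEigenvalues h0 h1,
      fun p hp => isPSummable_geometricEigenvalues_iff h0 h1 hp,
      fun x y h => cantorEDist_geometricEigenvalues_bounds h0 h1 h⟩⟩
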